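/- **Setting.** Let $d\ge 0$ and let $P\in\mathbb C[x,y]$ be a sum of homogeneous polynomials of degrees between $2$ and $d$. Put $Q(x,y)=\overline P(y,x)$, where $\overline P$ has the conjugate coefficients, and consider the real vector field written in complex form $$X=X_{lin}+P\,\partial_x+Q\,\partial_y,\qquad X_{lin}=i(x\partial_x-y\partial_y).$$ Let $p_{n}$ be the coefficient of $x^{n^1+1}y^{n^2}$ in $P$ and $q_n$ the coefficient of $x^{n^1}y^{n^2+1}$ in $Q$ (zero if there is no such monomial), so that $q_{(n^1,n^2)}=\overline{p_{(n^2,n^1)}}$. The alphabet is $$A=\{n\in\mathbb Z^2:\ n^1,n^2\ge -1,\ 1\le n^1+n^2\le d-1\}.$$ For a letter $n\in A$ put $B_n=x^{n^1}y^{n^2}(p_n\,x\partial_x+q_n\,y\partial_y)$ and $\omega(n)=i(n^1-n^2)$. For a word $\mathbf n=n_1\cdots n_r$ put $l(\mathbf n)=r$, $|\mathbf n|^j=\sum_k n_k^j$, $p(\mathbf n)=|\mathbf n|^1+|\mathbf n|^2$ (the depth), $B_{\mathbf n}=B_{n_1}\circ\cdots\circ B_{n_r}$ and $[B_{\mathbf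 n}]=[B_{n_1},[B_{n_2},[\dots,B_{n_r}]]]$. The word is resonant if $\omega(n_1)+\dots+\omega(n_r)=0$. Let $P(\mathbf n)$ and $Q(\mathbf n)$ be the coefficients of $x^{|\mathbf n|^1}y^{|\mathbf n|^2}\,x\partial_x$ and of $x^{|\mathbf n|^1}y^{|\mathbf n|^2}\,y\partial_y$ in $[B_{\mathbf n}]$. The correction $Carr(X)$ is the formal vector field $Z$, with no terms of degree less than $2$, such that $[X_{lin},Z]=0$ and $X-Z$ is formally conjugate to $X_{lin}$. Its part of depth $q$, denoted $Carr_q(X)$, is the part with coefficients homogeneous of degree $q+1$. Define functions $C_r(z_1,\dots,z_r)$ recursively by $C_0=0$, $C_1(z)=1$ if $z=0$ and $C_1(z)=0$ otherwise, and, for $r\ge2$, by $C_r(z_1,\dots,z_r)=0$ if $z_1=0$, while if $z_1\neq0$ the value is determined by $$z_1C_r(z_1,\dots,z_r)+C_{r-1}(z_1+z_2,z_3,\dots,z_r)=\sum_{\mathbf b\mathbf c=(z_2,\dots,z_r)}C(z_1,\mathbf c)\,C(\mathbf b).\tag{V}$$ Put $Carr^{n_1\cdots n_r}=C_r(\omega(n_r),\dots,\omega(n_1))$.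 **Theorem (Algebraic structure).** Let $p\ge1$. 1. The correction $Carr(X)$ exists and is unique. It satisfies $$Carr_{2p}(X)=\sum_{p(\mathbf n)=2p}Carr^{\mathbf n}B_{\mathbf n}=(xy)^p\left[Ca_{2p}(\mathbf p)\,x\partial_x+\overline{Ca_{2p}(\mathbf p)}\,y\partial_y\right],$$ $$Ca_{2p}=\sum_{i=1}^{2p}\frac1i\,Ca_{2p,i},\qquad Ca_{2p,i}=\sum_{p(\mathbf n)=2p,\ l(\mathbf n)=i}Carr^{\mathbf n}P(\mathbf n).$$ Here $[B_{\mathbf n}]=(xy)^p\left(P(\mathbf n)x\partial_x+Q(\mathbf n)y\partial_y\right)$ for every resonant word $\mathbf n$ of depth $2p$. 2. For $1\le i\le 2p$, $Ca_{2p,i}$ is given by an explicit polynomial, depending only on $d,p,i$, in the coefficients of $P$ and their complex conjugates. It is homogeneous of degree $i$ (possibly zero), and its coefficients lie in $\mathbb Q$ if $i$ is odd and in $i\mathbb Q$ (imaginary unit times $\mathbb Q$) if $i$ is even. This polynomial is $\sum Carr^{\mathbf n}P(\mathbf n)$ over the words of depth $2p$ and length $i$, with $P(\mathbf n)$ the integer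 polynomial of part 3. 3. These polynomials are computed recursively. The functions $C_r$ satisfy (V) for all $r\ge2$ and all $z_1,\dots,z_r\in\mathbb C$. For every word over $A$, $P(\mathbf n)$ and $Q(\mathbf n)$ are the values of the polynomials with integer coefficients in the $p_m$ and $\overline{p_m}$ defined by $P(n)=p_n$, $Q(n)=q_n$ and $$P(n\mathbf n)=(|\mathbf n|^1-n^1)p_nP(\mathbf n)+|\mathbf n|^2q_nP(\mathbf n)-n^2p_nQ(\mathbf n),$$ $$Q(n\mathbf n)=(|\mathbf n|^2-n^2)q_nQ(\mathbf n)+|\mathbf n|^1p_nQ(\mathbf n)-n^1q_nP(\mathbf n).$$ -/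

import Mathlib

noncomputable section

namespace CorrectionVF

/-! ### Formal vector fields on the plane -/

/-- Formal power series in the two variables `x = X 0` and `y = X 1`. -/
abbrev Ser : Type := MvPowerSeries (Fin 2) ℂ

/-- Formal vector fields, i.e. derivations of the algebra of formal power series. -/
abbrev VF : Type := Derivation ℂ Ser Ser

/-- The variable `x`. -/
abbrev sx : Ser := MvPowerSeries.X 0

/-- The variable `y`. -/
abbrev sy : Ser := MvPowerSeries.X 1

/-- A constant power series. -/
abbrev cst (a : ℂ) : Ser := MvPowerSeries.C a

/-- The vector field `a ∂x + b ∂y`. -/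
def vf (a b : Ser) : VF :=
  a • MvPowerSeries.pderiv ℂ (0 : Fin 2) + b • MvPowerSeries.pderiv ℂ (1 : Fin 2)

/-- The linear center `i (x ∂x - y ∂y)`. -/
def linCenter : VF := vf (cst Complex.I * sx) (-(cst Complex.I * sy))

/-- Formal conjugacy. A formal change of coordinates is given by its action on functions, an
automorphism of the algebra of formal power series. -/
def FormallyConjugate (U V : VF) : Prop :=
  ∃ Θ : Ser ≃ₐ[ℂ] Ser, ∀ f : Ser, U (Θ f) = Θ (V f)

/-- `Z` is the correction of a field `U` whose linear part is `linCenter`: it has no terms of degree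
less than two, it commutes with the linear part, and `U - Z` is formally conjugate to the linear
part. -/
structure IsCorrection (U Z : VF) : Prop where
  order_x : 2 ≤ (Z sx).order
  order_y : 2 ≤ (Z sy).order
  commutes : ⁅linCenter, Z⁆ = 0
  conjugate : FormallyConjugate (U - Z) linCenter

/-- The part of depth `q` of a vector field: the part whose coefficients are homogeneous of
degree `q + 1`. -/
def depthPart (q : ℕ) (Z : VF) : VF :=
  vf (MvPowerSeries.homogeneousComponent (q + 1) (Z sx))
    (MvPowerSeries.homogeneousComponent (q + 1) (Z sy))

/-! ### Real polynomial vector fields in complex form -/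

/-- The exponent of the monomial `x ^ a * y ^ b`. -/
def expo (a b : ℕ) : Fin 2 →₀ ℕ := Finsupp.single 0 a + Finsupp.single 1 b

/-- The polynomial `Q` with `Q (y, x)` equal to the conjugate of `P (x, y)` (where the conjugate of
`x` is `y`): conjugate the coefficients of `P` and exchange the variables. -/
def conjSwap (P : MvPolynomial (Fin 2) ℂ) : MvPolynomial (Fin 2) ℂ :=
  MvPolynomial.rename (Equiv.swap (0 : Fin 2) 1) (MvPolynomial.map (starRingEnd ℂ) P)

/-- The real vector field `i (x ∂x - y ∂y) + P ∂x + Q ∂y` in complex form. -/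
def realField (P : MvPolynomial (Fin 2) ℂ) : VF :=
  linCenter + vf (P : Ser) (conjSwap P : Ser)

/-- `P` is a sum of homogeneous polynomials of degrees `2, …, d`. -/
def IsPerturbation (d : ℕ) (P : MvPolynomial (Fin 2) ℂ) : Prop :=
  ∀ m ∈ P.support, 2 ≤ m.degree ∧ m.degree ≤ d

/-- The coefficient `p_n` of `x ^ (n.1 + 1) * y ^ n.2` in `P`; it is zero if there is no such
monomial. -/
def pc (P : MvPolynomial (Fin 2) ℂ) (n : ℤ × ℤ) : ℂ :=
  if -1 ≤ n.1 ∧ 0 ≤ n.2 then P.coeff (expo (n.1 + 1).toNat n.2.toNat) else 0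

/-- The coefficient `q_n` of `x ^ n.1 * y ^ (n.2 + 1)` in `Q`; it is zero if there is no such
monomial. -/
def qc (Q : MvPolynomial (Fin 2) ℂ) (n : ℤ × ℤ) : ℂ :=
  if 0 ≤ n.1 ∧ -1 ≤ n.2 then Q.coeff (expo n.1.toNat (n.2 + 1).toNat) else 0

/-- The homogeneous operator `B_n = x ^ n.1 y ^ n.2 (p_n x ∂x + q_n y ∂y)`. -/
def opB (P : MvPolynomial (Fin 2) ℂ) (n : ℤ × ℤ) : VF :=
  vf (cst (pc P n) * (sx ^ (n.1 + 1).toNat * sy ^ n.2.toNat))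
    (cst (qc (conjSwap P) n) * (sx ^ n.1.toNat * sy ^ (n.2 + 1).toNat))

/-! ### Letters and words -/

/-- The alphabet of a field of degree at most `d`: the letters `(k - 1, r - k)`, `0 ≤ k ≤ r + 1`,
for `2 ≤ r ≤ d`. -/
def alphabet (d : ℕ) : Finset (ℤ × ℤ) :=
  (Finset.Icc (-1 : ℤ) d ×ˢ Finset.Icc (-1 : ℤ) d).filter
    fun n => 1 ≤ n.1 + n.2 ∧ n.1 + n.2 ≤ (d : ℤ) - 1

/-- The sum of the first components of the letters of a word. -/
def size₁ (w : List (ℤ × ℤ)) : ℤ := (w.map Prod.fst).sum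

/-- The sum of the second components of the letters of a word. -/
def size₂ (w : List (ℤ × ℤ)) : ℤ := (w.map Prod.snd).sum

/-- The words of length `l` and depth `q` over the alphabet of degree `d`. -/
def words (d q l : ℕ) : Finset (List (ℤ × ℤ)) :=
  ((Fintype.piFinset fun _ : Fin l => alphabet d).image List.ofFn).filter
    fun w => size₁ w + size₂ w = (q : ℤ)

/-- The weight `⟨n, (i, -i)⟩` of a letter. -/
def weight (n : ℤ × ℤ) : ℂ := Complex.I * ((n.1 : ℂ) - (n.2 : ℂ))

/-- The composition `B_{n_1} ∘ ⋯ ∘ B_{n_r}`. -/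
def opWord (P : MvPolynomial (Fin 2) ℂ) (w : List (ℤ × ℤ)) : Module.End ℂ Ser :=
  (w.map fun n => ((opB P n : VF) : Ser →ₗ[ℂ] Ser)).prod

/-- The nested bracket `[B_{n_1}, [B_{n_2}, […, B_{n_r}]]]`. -/
def nested (P : MvPolynomial (Fin 2) ℂ) : List (ℤ × ℤ) → VF
  | [] => 0
  | [n] => opB P n
  | n :: m :: t => ⁅opB P n, nested P (m :: t)⁆

/-- The coefficient `P(w)` of `x ^ size₁ w y ^ size₂ w · x ∂x` in the nested bracket of `w`. -/
def bracketP (P : MvPolynomial (Fin 2) ℂ) (w : List (ℤ × ℤ)) : ℂ :=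
  MvPowerSeries.coeff (expo (size₁ w + 1).toNat (size₂ w).toNat) (nested P w sx)

/-- The coefficient `Q(w)` of `x ^ size₁ w y ^ size₂ w · y ∂y` in the nested bracket of `w`. -/
def bracketQ (P : MvPolynomial (Fin 2) ℂ) (w : List (ℤ × ℤ)) : ℂ :=
  MvPowerSeries.coeff (expo (size₁ w).toNat (size₂ w + 1).toNat) (nested P w sy)

/-! ### The mould of the correction -/

/-- The universal functions `C_r (z_1, …, z_r)` of the correction, by recursion on `r`: the value is
`0` on the empty word, it is `1` or `0` on a single letter according to whether its weight vanishes,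
and for longer words the variance formula
`z_1 C(z_1, z_2, …) + C(z_1 + z_2, …) = ∑ C(z_1, c) C(b)`, the sum over `b c = (z_2, …, z_r)`,
is solved for its first term if `z_1 ≠ 0`, and the value is `0` if `z_1 = 0`. -/
def carr : List ℂ → ℂ
  | [] => 0
  | [z] => if z = 0 then 1 else 0
  | z₁ :: z₂ :: t =>
    if z₁ = 0 then 0
    else z₁⁻¹ * (-carr ((z₁ + z₂) :: t)
      + ∑ j : Fin (t.length + 1), carr (z₁ :: t.drop j) * carr (z₂ :: t.take j))
  termination_by l => l.length
  decreasing_by all_goals (simp only [List.length_cons, List.length_drop, List.length_take]; omega)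

/-- The mould `Carr^w`. In the variance formula the letters of a word act in the order in which they
are written (the operator of `n_1 ⋯ n_r` is `B_{n_r} ∘ ⋯ ∘ B_{n_1}`), so that for
`B_{n_1} ∘ ⋯ ∘ B_{n_r}` the weights are read from the last letter to the first. -/
def mould (w : List (ℤ × ℤ)) : ℂ := carr (w.map weight).reverse

/-- `∑ Carr^w B_w` over all words of depth `q`; such a word has length at most `q`. -/
def mouldTerm (P : MvPolynomial (Fin 2) ℂ) (d q : ℕ) : Module.End ℂ Ser :=
  ∑ l ∈ Finset.Icc 1 q, ∑ w ∈ words d q l, mould w • opWord P w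

/-- `Ca_{2p,l}`, the sum of `Carr^w P(w)` over the words of depth `2p` and length `l`. -/
def caLen (P : MvPolynomial (Fin 2) ℂ) (d p l : ℕ) : ℂ :=
  ∑ w ∈ words d (2 * p) l, mould w * bracketP P w

/-- `Ca_{2p}`. -/
def ca (P : MvPolynomial (Fin 2) ℂ) (d p : ℕ) : ℂ :=
  ∑ l ∈ Finset.Icc 1 (2 * p), (1 / (l : ℂ)) * caLen P d p l

/-! ### The same quantities as polynomials in the coefficients -/

/-- Polynomials over `R` in indeterminates for the coefficients `p_n` of `P` (`Sum.inl n`) and for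
their complex conjugates (`Sum.inr n`). -/
abbrev CoeffPoly (R : Type) [CommSemiring R] : Type := MvPolynomial ((ℤ × ℤ) ⊕ (ℤ × ℤ)) R

/-- The indeterminate coefficient `p_n`, which is absent for `n = (r, -1)`. -/
def varP (n : ℤ × ℤ) : CoeffPoly ℤ :=
  if 0 ≤ n.2 then MvPolynomial.X (Sum.inl n) else 0

/-- The indeterminate coefficient `q_n`, the conjugate of `p_m` for the letter `m = (n.2, n.1)`;
it is absent for `n = (-1, r)`. -/
def varQ (n : ℤ × ℤ) : CoeffPoly ℤ :=
  if 0 ≤ n.1 then MvPolynomial.X (Sum.inr n.swap) else 0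

/-- `P(w)` and `Q(w)` as polynomials with integer coefficients, by recursion on the length. -/
def genPQ : List (ℤ × ℤ) → CoeffPoly ℤ × CoeffPoly ℤ
  | [] => (0, 0)
  | [n] => (varP n, varQ n)
  | n :: m :: t =>
    let P := (genPQ (m :: t)).1
    let Q := (genPQ (m :: t)).2
    let s₁ := size₁ (m :: t)
    let s₂ := size₂ (m :: t)
    ((s₁ - n.1) • (varP n * P) + s₂ • (varQ n * P) - n.2 • (varP n * Q),
      (s₂ - n.2) • (varQ n * Q) + s₁ • (varP n * Q) - n.1 • (varQ n * P))

/-- The values of the indeterminates for a given `P`. -/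
def coeffVal (P : MvPolynomial (Fin 2) ℂ) : (ℤ × ℤ) ⊕ (ℤ × ℤ) → ℂ :=
  Sum.elim (pc P) fun n => starRingEnd ℂ (pc P n)

/-- `Ca_{2p,l}` as a polynomial in the coefficients of `P` and their conjugates. -/
def caPoly (d p l : ℕ) : CoeffPoly ℂ :=
  ∑ w ∈ words d (2 * p) l,
    MvPolynomial.C (mould w) * MvPolynomial.map (Int.castRingHom ℂ) (genPQ w).1

end CorrectionVF

end

noncomputable section

namespace CorrectionVF

open Finset

/-! ### The free associative algebra with weighted letters -/

/-! Let `L` be the sum of the letters and let `D` multiply each word by its weight. When letters are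
replaced by the operators `opB`, `D` becomes the bracket with `linCenter` (`linCenter_mul_rep_sub`).
So it suffices to find, in the free algebra graded by length, a resonant `R` and an invertible `Θ`
with `DΘ + LΘ = RΘ`: on operators this reads `(X_lin + L - R) Θ = Θ X_lin`.

With a formal parameter `t` marking length, prescribe `t dΘ/dt = GΘ`. Differentiating the conjugacy
gives the homological equation `t dR/dt - DG = L - [G, L - R]`, solved length by length: the
resonant part of the right side, divided by the length, is `R`; the rest, divided by the weight, is
`-G`. The defect `Y = DΘ + LΘ - RΘ` then satisfies `t dY/dt = GY` and starts at zero, hence vanishes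
(`normSer_equation`). Only brackets are used, so `R` and `G` are Lie elements. Their images are
derivations, `Θ` becomes an algebra automorphism (`coeff_normOp_mul`), and the series converge
because each letter raises the order by at least one.

To identify `R`, let `V` multiply a word of weight `z` on the left by the sum of all words weighted
by `C(z, ...)`, and let `M` be the sum of all words weighted by the mould. The variance formula says
`V(DF + LF) = V(MF)`. At `F = Θ` the left side is also `V(RΘ)`. The length-zero part of `V` is the
projection onto resonant words, which fixes `R` and `M`, so `R = M` by induction on length
(`resPart_eq_mouldSum`). The Dynkin operator multiplies a Lie element of length `l` by `l`; this
turns the sum of compositions into a sum of nested brackets and produces the factor `1/l`.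

For uniqueness, the difference of two corrections commutes with `linCenter`. Its lowest-order part
is resonant, and comparing eigenvectors under the two conjugacies kills it
(`IsCorrection.eq_correction`).

The conjugate coefficient of `y ∂y` comes from the symmetry exchanging the two components of every
letter (`conj_caLen`). The alternation between `ℚ` and `iℚ` comes from the mould having degree `1 -
r` on words of length `r` (`carr_imaginary`). -/

/-- The free associative algebra on the letters `ι`. -/
def FA (ι : Type*) : Type _ := MonoidAlgebra ℂ (FreeMonoid ι)

instance (ι : Type*) : Ring (FA ι) := inferInstanceAs (Ring (MonoidAlgebra ℂ (FreeMonoid ι)))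

instance (ι : Type*) : Algebra ℂ (FA ι) :=
  inferInstanceAs (Algebra ℂ (MonoidAlgebra ℂ (FreeMonoid ι)))

instance (ι : Type*) : LieRing (FA ι) := LieRing.ofAssociativeRing

section FreeAlgebra

variable {ι : Type*} {M : Type*} [AddCommMonoid M] [Module ℂ M]

/-- The basis element of the free algebra given by a word. -/
def wd (w : List ι) : FA ι :=
  (MonoidAlgebra.single (FreeMonoid.ofList w) 1 : MonoidAlgebra ℂ (FreeMonoid ι))

/-- The linear map with prescribed values on words. -/
def onWords (f : List ι → M) : FA ι →ₗ[ℂ] M :=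
  Finsupp.linearCombination ℂ (fun w : FreeMonoid ι => f w.toList) ∘ₗ
    (MonoidAlgebra.coeffLinearEquiv ℂ :
      MonoidAlgebra ℂ (FreeMonoid ι) ≃ₗ[ℂ] (FreeMonoid ι →₀ ℂ)).toLinearMap

@[simp] theorem onWords_wd (f : List ι → M) (w : List ι) : onWords f (wd w) = f w := by
  change Finsupp.linearCombination ℂ (fun w : FreeMonoid ι => f w.toList)
    (Finsupp.single (FreeMonoid.ofList w) 1) = f w
  simp

theorem wd_mul_wd (u v : List ι) : wd u * wd v = wd (u ++ v) := by
  refine (MonoidAlgebra.single_mul_single _ _ _ _).trans ?_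
  simp [wd, FreeMonoid.ofList_append]

theorem wd_nil : wd ([] : List ι) = 1 := rfl

theorem wd_cons (n : ι) (w : List ι) : wd (n :: w) = wd [n] * wd w := by
  simp [wd_mul_wd]

theorem linearMap_ext_wd {f g : FA ι →ₗ[ℂ] M} (h : ∀ w, f (wd w) = g (wd w)) : f = g := by
  refine MonoidAlgebra.lhom_ext' fun w => LinearMap.ext_ring ?_
  exact h (FreeMonoid.toList w)

theorem eq_of_wd {f g : FA ι →ₗ[ℂ] M} (h : ∀ w, f (wd w) = g (wd w)) (F : FA ι) : f F = g F := by
  rw [linearMap_ext_wd h]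

/-! ### Functional calculus of a weight -/

variable {G : Type*} [AddCommMonoid G]

/-- The total weight of a word. -/
def wt (ω : ι → G) (w : List ι) : G := (w.map ω).sum

@[simp] theorem wt_nil (ω : ι → G) : wt ω [] = 0 := rfl

@[simp] theorem wt_cons (ω : ι → G) (n : ι) (w : List ι) : wt ω (n :: w) = ω n + wt ω w := by
  simp [wt]

@[simp] theorem wt_append (ω : ι → G) (u v : List ι) : wt ω (u ++ v) = wt ω u + wt ω v := by
  simp [wt]

/-- Multiply every word by a function of its weight. -/
def weightCalc (ω : ι → G) (φ : G → ℂ) : FA ι →ₗ[ℂ] FA ι := onWords fun w => φ (wt ω w) • wd w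

@[simp] theorem weightCalc_wd (ω : ι → G) (φ : G → ℂ) (w : List ι) :
    weightCalc ω φ (wd w) = φ (wt ω w) • wd w := onWords_wd _ _

theorem weightCalc_letter_mul (ω : ι → G) (φ : G → ℂ) (n : ι) (F : FA ι) :
    weightCalc ω φ (wd [n] * F) = wd [n] * weightCalc ω (fun g => φ (ω n + g)) F := by
  refine eq_of_wd (f := weightCalc ω φ ∘ₗ LinearMap.mulLeft ℂ (wd [n]))
    (g := LinearMap.mulLeft ℂ (wd [n]) ∘ₗ weightCalc ω (fun g => φ (ω n + g))) (fun w => ?_) F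
  simp [wd_mul_wd]

theorem weightCalc_mul_letter (ω : ι → G) (φ : G → ℂ) (n : ι) (F : FA ι) :
    weightCalc ω φ (F * wd [n]) = weightCalc ω (fun g => φ (ω n + g)) F * wd [n] := by
  refine eq_of_wd (f := weightCalc ω φ ∘ₗ LinearMap.mulRight ℂ (wd [n]))
    (g := LinearMap.mulRight ℂ (wd [n]) ∘ₗ weightCalc ω (fun g => φ (ω n + g))) (fun w => ?_) F
  simp [wd_mul_wd, add_comm]

theorem weightCalc_comp (ω : ι → G) (φ ψ : G → ℂ) (F : FA ι) :
    weightCalc ω φ (weightCalc ω ψ F) = weightCalc ω (fun g => φ g * ψ g) F := by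
  refine eq_of_wd (f := weightCalc ω φ ∘ₗ weightCalc ω ψ) (fun w => ?_) F
  simp [smul_smul, mul_comm]

theorem weightCalc_add (ω : ι → G) (φ ψ : G → ℂ) (F : FA ι) :
    weightCalc ω φ F + weightCalc ω ψ F = weightCalc ω (fun g => φ g + ψ g) F := by
  refine eq_of_wd (f := weightCalc ω φ + weightCalc ω ψ) (fun w => ?_) F
  simp [add_smul]

theorem weightCalc_zero (ω : ι → G) (F : FA ι) : weightCalc ω (fun _ => 0) F = 0 := by
  refine eq_of_wd (g := 0) (fun w => ?_) F
  simp

theorem weightCalc_one (ω : ι → G) (F : FA ι) : weightCalc ω (fun _ => 1) F = F := by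
  refine eq_of_wd (g := LinearMap.id) (fun w => ?_) F
  simp

/-- Weights add under concatenation, so multiplication by the weight is a derivation. It is the
formal counterpart of the bracket with the linear field. -/
theorem weightCalc_id_mul (ω : ι → ℂ) (F H : FA ι) :
    weightCalc ω id (F * H) = weightCalc ω id F * H + F * weightCalc ω id H := by
  refine eq_of_wd (f := weightCalc ω id ∘ₗ LinearMap.mulRight ℂ H)
    (g := LinearMap.mulRight ℂ H ∘ₗ weightCalc ω id + LinearMap.mulRight ℂ (weightCalc ω id H))
    (fun w => ?_) F
  refine eq_of_wd (f := weightCalc ω id ∘ₗ LinearMap.mulLeft ℂ (wd w))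
    (g := LinearMap.mulLeft ℂ (weightCalc ω id (wd w)) +
      LinearMap.mulLeft ℂ (wd w) ∘ₗ weightCalc ω id) (fun v => ?_) H
  simp [wd_mul_wd, add_smul]

/-! ### Nested commutators -/

/-- The nested commutator of the letters of a word. -/
def nest : List ι → FA ι
  | [] => 0
  | [n] => wd [n]
  | n :: m :: t => ⁅wd [n], nest (m :: t)⁆

/-- All words occurring in a nested commutator are rearrangements of the same letters. The function
`φ` is generalized because pulling out a letter shifts its argument. -/
theorem weightCalc_nest (ω : ι → G) (w : List ι) (φ : G → ℂ) :
    weightCalc ω φ (nest w) = φ (wt ω w) • nest w := by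
  induction w using nest.induct generalizing φ with
  | case1 => simp [nest]
  | case2 n => simp [nest]
  | case3 n m t ih =>
    rw [nest, Ring.lie_def, map_sub, weightCalc_letter_mul, weightCalc_mul_letter, ih, wt_cons]
    simp [smul_sub]

/-- The span of the nested commutators of length `l` in the letters of `A`. -/
def lieSpan (A : Finset ι) (l : ℕ) : Submodule ℂ (FA ι) :=
  Submodule.span ℂ {x | ∃ w : List ι, w.length = l ∧ (∀ n ∈ w, n ∈ A) ∧ nest w = x}

theorem nest_mem_lieSpan {A : Finset ι} {w : List ι} (h : ∀ n ∈ w, n ∈ A) :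
    nest w ∈ lieSpan A w.length := Submodule.subset_span ⟨w, rfl, h, rfl⟩

theorem letter_lie_mem_lieSpan {A : Finset ι} {n : ι} (hn : n ∈ A) {l : ℕ} {y : FA ι}
    (hy : y ∈ lieSpan A l) : ⁅wd [n], y⁆ ∈ lieSpan A (l + 1) := by
  induction hy using Submodule.span_induction with
  | mem x hx =>
    obtain ⟨w, rfl, hw, rfl⟩ := hx
    rcases w with _ | ⟨m, t⟩
    · simp [nest]
    · exact nest_mem_lieSpan (w := n :: m :: t) (by simpa [hn] using hw)
  | zero => simp
  | add x y _ _ hx hy => rw [lie_add]; exact add_mem hx hy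
  | smul a x _ hx => rw [lie_smul]; exact Submodule.smul_mem _ _ hx

/-- By Jacobi, `[[n, u], y] = [n, [u, y]] - [u, [n, y]]`, which restores right-nested form. The
second term forces `y` to vary in the induction. -/
theorem nest_lie_mem_lieSpan {A : Finset ι} (w : List ι) (hw : ∀ n ∈ w, n ∈ A) {l : ℕ} {y : FA ι}
    (hy : y ∈ lieSpan A l) : ⁅nest w, y⁆ ∈ lieSpan A (w.length + l) := by
  induction w using nest.induct generalizing l y with
  | case1 => simp [nest]
  | case2 n =>
    rw [nest, List.length_singleton, add_comm]
    exact letter_lie_mem_lieSpan (hw n (by simp)) hy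
  | case3 n m t ih =>
    have hn : n ∈ A := hw n (by simp)
    have ht : ∀ k ∈ m :: t, k ∈ A := fun k hk => hw k (List.mem_cons_of_mem _ hk)
    rw [nest, lie_lie]
    refine sub_mem ?_ ?_
    · have := letter_lie_mem_lieSpan hn (ih ht hy)
      rwa [show (m :: t).length + l + 1 = (n :: m :: t).length + l by simp; ring] at this
    · have := ih ht (letter_lie_mem_lieSpan hn hy)
      rwa [show (m :: t).length + (l + 1) = (n :: m :: t).length + l by simp; ring] at this

theorem lie_mem_lieSpan {A : Finset ι} {k l : ℕ} {x y : FA ι} (hx : x ∈ lieSpan A k)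
    (hy : y ∈ lieSpan A l) : ⁅x, y⁆ ∈ lieSpan A (k + l) := by
  induction hx using Submodule.span_induction with
  | mem x hx =>
    obtain ⟨w, rfl, hw, rfl⟩ := hx
    exact nest_lie_mem_lieSpan w hw hy
  | zero => simp
  | add x y _ _ hx hy => rw [add_lie]; exact add_mem hx hy
  | smul a x _ hx => rw [smul_lie]; exact Submodule.smul_mem _ _ hx

theorem weightCalc_mem_lieSpan (ω : ι → G) (φ : G → ℂ) {A : Finset ι} {l : ℕ} {x : FA ι}
    (hx : x ∈ lieSpan A l) : weightCalc ω φ x ∈ lieSpan A l := by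
  induction hx using Submodule.span_induction with
  | mem x hx =>
    obtain ⟨w, rfl, hw, rfl⟩ := hx
    rw [weightCalc_nest]
    exact Submodule.smul_mem _ _ (nest_mem_lieSpan hw)
  | zero => simp
  | add x y _ _ hx hy => rw [map_add]; exact add_mem hx hy
  | smul a x _ hx => rw [map_smul]; exact Submodule.smul_mem _ _ hx

/-! ### The Dynkin operator -/

/-- The Dynkin operator, which replaces a word by its nested commutator. -/
def dynkin : FA ι →ₗ[ℂ] FA ι := onWords nest

/-- The coefficient of the empty word. -/
def emptyCoeff : FA ι →ₗ[ℂ] ℂ := onWords fun w => if w = [] then 1 else 0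

theorem emptyCoeff_letter_mul (n : ι) (F : FA ι) : emptyCoeff (wd [n] * F) = 0 := by
  refine eq_of_wd (f := emptyCoeff ∘ₗ LinearMap.mulLeft ℂ (wd [n])) (g := 0) (fun w => ?_) F
  simp [wd_mul_wd, emptyCoeff]

theorem emptyCoeff_mul (F H : FA ι) : emptyCoeff (F * H) = emptyCoeff F * emptyCoeff H := by
  refine eq_of_wd (f := emptyCoeff ∘ₗ LinearMap.mulRight ℂ H)
    (g := LinearMap.mulRight ℂ (emptyCoeff H) ∘ₗ emptyCoeff) (fun w => ?_) F
  refine eq_of_wd (f := emptyCoeff ∘ₗ LinearMap.mulLeft ℂ (wd w))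
    (g := LinearMap.mulLeft ℂ (emptyCoeff (wd w)) ∘ₗ emptyCoeff) (fun v => ?_) H
  by_cases hw : w = [] <;> by_cases hv : v = [] <;> simp [wd_mul_wd, emptyCoeff, hw, hv]

/-- The last term accounts for the empty word: prefixing a letter to it gives that letter, while the
commutator with its Dynkin image is zero. -/
theorem dynkin_letter_mul (n : ι) (F : FA ι) :
    dynkin (wd [n] * F) = ⁅wd [n], dynkin F⁆ + emptyCoeff F • wd [n] := by
  refine eq_of_wd (f := dynkin ∘ₗ LinearMap.mulLeft ℂ (wd [n]))
    (g := (LinearMap.mulLeft ℂ (wd [n]) - LinearMap.mulRight ℂ (wd [n])) ∘ₗ dynkin +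
      emptyCoeff.smulRight (wd [n])) (fun w => ?_) F
  rcases w with _ | ⟨m, t⟩
  · simp [emptyCoeff, dynkin, nest, wd_mul_wd]
  · simp [wd_mul_wd, emptyCoeff, dynkin, nest, Ring.lie_def]

/-- On elements without constant term, left multiplication by a letter becomes its adjoint action.
The adjoint action respects commutators, so this extends to Lie elements. -/
theorem dynkin_nest_mul (w : List ι) (F : FA ι) (hF : emptyCoeff F = 0) :
    dynkin (nest w * F) = ⁅nest w, dynkin F⁆ := by
  induction w using nest.induct generalizing F with
  | case1 => simp [nest]
  | case2 n => simp [nest, dynkin_letter_mul, hF]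
  | case3 n m t ih =>
    rw [nest, Ring.lie_def, sub_mul, mul_assoc, mul_assoc, map_sub, dynkin_letter_mul, ih F hF,
      ih _ (emptyCoeff_letter_mul n F), dynkin_letter_mul, hF, emptyCoeff_mul, hF,
      ← Ring.lie_def, lie_lie]
    simp

/-- The Dynkin-Specht-Wever theorem. For `u` a nested commutator of length `l`, the image of `[n, u]
= nu - un` is `[n, l u] - [u, n] = (l + 1) [n, u]`. -/
theorem dynkin_nest (w : List ι) : dynkin (nest w) = (w.length : ℂ) • nest w := by
  induction w using nest.induct with
  | case1 => simp [nest]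
  | case2 n => simp [nest, dynkin]
  | case3 n m t ih =>
    have h1 : emptyCoeff (wd [n]) = 0 := by simp [emptyCoeff]
    have h0 : emptyCoeff (nest (m :: t)) = 0 := by
      rcases t with _ | ⟨k, s⟩
      · simp [nest, emptyCoeff]
      · simp only [nest, Ring.lie_def, map_sub, emptyCoeff_mul]
        ring
    have h2 : dynkin (wd [n]) = wd [n] := by simp [dynkin, nest]
    rw [nest, Ring.lie_def, map_sub, dynkin_letter_mul, dynkin_nest_mul _ _ h1, ih, h2, h0,
      ← Ring.lie_def, lie_smul, ← lie_skew (nest (m :: t)) (wd [n])]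
    rw [show ((n :: m :: t).length : ℂ) = ((m :: t).length : ℂ) + 1 by simp, add_smul, one_smul,
      zero_smul, add_zero, sub_neg_eq_add]

theorem dynkin_of_mem_lieSpan {A : Finset ι} {l : ℕ} {x : FA ι} (hx : x ∈ lieSpan A l) :
    dynkin x = (l : ℂ) • x := by
  induction hx using Submodule.span_induction with
  | mem x hx =>
    obtain ⟨w, rfl, hw, rfl⟩ := hx
    exact dynkin_nest w
  | zero => simp
  | add x y _ _ hx hy => rw [map_add, hx, hy, smul_add]
  | smul a x _ hx => rw [map_smul, hx, smul_comm]

end FreeAlgebra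

/-! ### Graded linear differential equations -/

section Euler

variable {R : Type*} [Ring R]

/-- The Euler operator `t d/dt` on power series. -/
def euler (F : PowerSeries R) : PowerSeries R := PowerSeries.mk fun n => n • PowerSeries.coeff n F

@[simp] theorem coeff_euler (n : ℕ) (F : PowerSeries R) :
    PowerSeries.coeff n (euler F) = n • PowerSeries.coeff n F := PowerSeries.coeff_mk _ _

theorem euler_add (F H : PowerSeries R) : euler (F + H) = euler F + euler H := by
  ext n; simp

theorem euler_sub (F H : PowerSeries R) : euler (F - H) = euler F - euler H := by
  ext n; simp [smul_sub]

theorem euler_mul (F H : PowerSeries R) : euler (F * H) = euler F * H + F * euler H := by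
  ext n
  simp only [coeff_euler, map_add, PowerSeries.coeff_mul, smul_sum, ← sum_add_distrib]
  refine sum_congr rfl fun p hp => ?_
  rw [← mem_antidiagonal.1 hp, add_smul, smul_mul_assoc, mul_smul_comm]

/-- Apply an additive map to the coefficients of a power series. -/
def mapCoeff (f : R →+ R) (F : PowerSeries R) : PowerSeries R :=
  PowerSeries.mk fun n => f (PowerSeries.coeff n F)

@[simp] theorem coeff_mapCoeff (f : R →+ R) (n : ℕ) (F : PowerSeries R) :
    PowerSeries.coeff n (mapCoeff f F) = f (PowerSeries.coeff n F) := PowerSeries.coeff_mk _ _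

theorem mapCoeff_mul {f : R →+ R} (hf : ∀ a b, f (a * b) = f a * b + a * f b)
    (F H : PowerSeries R) : mapCoeff f (F * H) = mapCoeff f F * H + F * mapCoeff f H := by
  ext n
  simp [PowerSeries.coeff_mul, hf, sum_add_distrib]

theorem euler_mapCoeff (f : R →+ R) (F : PowerSeries R) :
    euler (mapCoeff f F) = mapCoeff f (euler F) := by
  ext n; rw [coeff_euler, coeff_mapCoeff, coeff_mapCoeff, coeff_euler, map_nsmul]

/-- Since `W` has no constant term, `n` times the coefficient of degree `n` depends only on lower
coefficients of `Y`. -/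
theorem eq_zero_of_euler_eq [Algebra ℂ R] {W Y : PowerSeries R}
    (hW : PowerSeries.coeff 0 W = 0) (hY : PowerSeries.coeff 0 Y = 0) (h : euler Y = W * Y) :
    Y = 0 := by
  ext n
  induction n using Nat.strong_induction_on with
  | _ n ih =>
    rcases Nat.eq_zero_or_pos n with rfl | hn
    · simpa using hY
    · have := congrArg (PowerSeries.coeff n) h
      rw [coeff_euler, ← Nat.cast_smul_eq_nsmul ℂ, PowerSeries.coeff_mul, sum_eq_zero] at this
      · simpa using (smul_eq_zero_iff_right (Nat.cast_ne_zero.2 hn.ne')).1 this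
      · intro p hp
        have hp' := mem_antidiagonal.1 hp
        rcases Nat.eq_zero_or_pos p.1 with h0 | h0
        · rw [h0, hW, zero_mul]
        · rw [ih p.2 (by omega)]; simp

/-- The coefficients of the solution of `t dΘ/dt = W Θ` with constant term one. -/
def flowCoeff [Algebra ℂ R] (W : ℕ → R) : ℕ → R
  | 0 => 1
  | n + 1 => ((n + 1 : ℕ) : ℂ)⁻¹ • ∑ a : Fin (n + 1), W (a + 1) * flowCoeff W (n - a)
  decreasing_by omega

theorem euler_flow [Algebra ℂ R] (W : PowerSeries R) (hW : PowerSeries.coeff 0 W = 0) :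
    euler (PowerSeries.mk (flowCoeff fun n => PowerSeries.coeff n W)) =
      W * PowerSeries.mk (flowCoeff fun n => PowerSeries.coeff n W) := by
  ext n
  rw [coeff_euler, PowerSeries.coeff_mul, PowerSeries.coeff_mk]
  rcases n with _ | n
  · simp [hW]
  · rw [flowCoeff, Nat.sum_antidiagonal_succ, hW, Nat.sum_antidiagonal_eq_sum_range_succ_mk,
      ← Nat.cast_smul_eq_nsmul ℂ, smul_smul, mul_inv_cancel₀ (Nat.cast_ne_zero.2 n.succ_ne_zero),
      one_smul, zero_mul, zero_add, Fin.sum_univ_eq_sum_range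
        (fun a => PowerSeries.coeff (a + 1) W * flowCoeff (fun n => PowerSeries.coeff n W) (n - a))]
    simp

end Euler

/-! ### The graded normal form in the free algebra -/

section NormalForm

variable {ι : Type*} (A : Finset ι) (ω : ι → ℂ)

/-- The sum of the letters, placed in degree one. -/
def letterSum (l : ℕ) : FA ι := if l = 1 then ∑ n ∈ A, wd [n] else 0

/-- The terms of length `l` of the resonant part and of the generator of the normalization. -/
def normalPair (l : ℕ) : FA ι × FA ι :=
  let r := letterSum A l - ∑ a : Fin l, if h : (a : ℕ) = 0 then 0 else
    ⁅(normalPair a).2, letterSum A (l - a) - (normalPair (l - a)).1⁆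
  ((l : ℂ)⁻¹ • weightCalc ω (fun z => if z = 0 then 1 else 0) r,
    -weightCalc ω (fun z => z⁻¹) r)
  termination_by l
  decreasing_by all_goals omega

/-- The terms of length `l` of the resonant part. -/
def resPart (l : ℕ) : FA ι := (normalPair A ω l).1

/-- The terms of length `l` of the generator of the normalization. -/
def genPart (l : ℕ) : FA ι := (normalPair A ω l).2

/-- The right-hand side of the homological equation. -/
def homRhs (l : ℕ) : FA ι :=
  letterSum A l - ∑ a : Fin l, if (a : ℕ) = 0 then 0 else
    ⁅genPart A ω a, letterSum A (l - a) - resPart A ω (l - a)⁆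

theorem resPart_eq (l : ℕ) : resPart A ω l =
    (l : ℂ)⁻¹ • weightCalc ω (fun z => if z = 0 then 1 else 0) (homRhs A ω l) := by
  rw [resPart, normalPair]; rfl

theorem genPart_eq (l : ℕ) : genPart A ω l = -weightCalc ω (fun z => z⁻¹) (homRhs A ω l) := by
  rw [genPart, normalPair]; rfl

theorem homRhs_zero : homRhs A ω 0 = 0 := by simp [homRhs, letterSum]

theorem resPart_zero : resPart A ω 0 = 0 := by simp [resPart_eq]

theorem genPart_zero : genPart A ω 0 = 0 := by simp [genPart_eq, homRhs_zero]

theorem letterSum_mem_lieSpan (l : ℕ) : letterSum A l ∈ lieSpan A l := by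
  unfold letterSum
  split_ifs with h
  · subst h
    refine sum_mem fun n hn => ?_
    exact nest_mem_lieSpan (w := [n]) (by simpa using hn)
  · exact zero_mem _

theorem homRhs_mem_lieSpan (l : ℕ) : homRhs A ω l ∈ lieSpan A l := by
  induction l using Nat.strong_induction_on with
  | _ l ih =>
    refine sub_mem (letterSum_mem_lieSpan A l) (sum_mem fun a _ => ?_)
    split_ifs with h
    · exact zero_mem _
    · have h1 : genPart A ω a ∈ lieSpan A a := by
        rw [genPart_eq]
        exact neg_mem (weightCalc_mem_lieSpan _ _ (ih a a.2))
      have h2 : resPart A ω (l - a) ∈ lieSpan A (l - a) := by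
        rw [resPart_eq]
        exact Submodule.smul_mem _ _ (weightCalc_mem_lieSpan _ _ (ih _ (by omega)))
      have := lie_mem_lieSpan h1 (sub_mem (letterSum_mem_lieSpan A (l - a)) h2)
      rwa [show (a : ℕ) + (l - a) = l by omega] at this

theorem genPart_mem_lieSpan (l : ℕ) : genPart A ω l ∈ lieSpan A l := by
  rw [genPart_eq]
  exact neg_mem (weightCalc_mem_lieSpan _ _ (homRhs_mem_lieSpan A ω l))

theorem resPart_mem_lieSpan (l : ℕ) : resPart A ω l ∈ lieSpan A l := by
  rw [resPart_eq]
  exact Submodule.smul_mem _ _ (weightCalc_mem_lieSpan _ _ (homRhs_mem_lieSpan A ω l))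

theorem weightCalc_resPart (l : ℕ) :
    weightCalc ω (fun z => if z = 0 then 1 else 0) (resPart A ω l) = resPart A ω l := by
  rw [resPart_eq, map_smul, weightCalc_comp]
  congr 3
  funext z
  split_ifs <;> simp

theorem weightCalc_id_resPart (l : ℕ) : weightCalc ω id (resPart A ω l) = 0 := by
  rw [← weightCalc_resPart, weightCalc_comp, ← weightCalc_zero ω (resPart A ω l)]
  congr 2
  funext z
  split_ifs with h <;> simp [h]

/-- The indicator of `z = 0` and `z * z⁻¹` add up to one. The convention `0⁻¹ = 0` removes the
resonant words from the generator, so no case split is needed in its definition. -/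
theorem homological_equation (l : ℕ) :
    (l : ℂ) • resPart A ω l - weightCalc ω id (genPart A ω l) = homRhs A ω l := by
  rcases Nat.eq_zero_or_pos l with rfl | hl
  · simp [homRhs_zero, genPart_zero]
  · rw [resPart_eq, genPart_eq, smul_smul, mul_inv_cancel₀ (Nat.cast_ne_zero.2 hl.ne'), one_smul,
      map_neg, sub_neg_eq_add, weightCalc_comp, weightCalc_add]
    conv_rhs => rw [← weightCalc_one ω (homRhs A ω l)]
    congr 2
    funext z
    by_cases h : z = 0 <;> simp [h]

/-- The sum of the letters, the resonant part and the generator as series graded by length. -/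
def letterSer : PowerSeries (FA ι) := PowerSeries.mk (letterSum A)

/-- The resonant part. -/
def resSer : PowerSeries (FA ι) := PowerSeries.mk (resPart A ω)

/-- The generator of the normalization. -/
def genSer : PowerSeries (FA ι) := PowerSeries.mk (genPart A ω)

/-- The normalization. -/
def normSer : PowerSeries (FA ι) := PowerSeries.mk (flowCoeff (genPart A ω))

theorem euler_resSer : letterSer A - euler (resSer A ω) =
    genSer A ω * (letterSer A - resSer A ω) - (letterSer A - resSer A ω) * genSer A ω -
      mapCoeff (weightCalc ω id).toAddMonoidHom (genSer A ω) := by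
  ext l
  -- The definition sums only over `0 < a < l`. The missing end terms vanish because the generator,
  -- the letters and the resonant part have no term of length zero.
  have hsum : PowerSeries.coeff l (genSer A ω * (letterSer A - resSer A ω) -
      (letterSer A - resSer A ω) * genSer A ω) = ∑ a : Fin l, if (a : ℕ) = 0 then 0 else
    ⁅genPart A ω a, letterSum A (l - a) - resPart A ω (l - a)⁆ := by
    rw [map_sub, PowerSeries.coeff_mul, PowerSeries.coeff_mul,
      ← Nat.sum_antidiagonal_swap (n := l) (f := fun p => PowerSeries.coeff p.1
        (letterSer A - resSer A ω) * PowerSeries.coeff p.2 (genSer A ω)), ← sum_sub_distrib,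
      Nat.sum_antidiagonal_eq_sum_range_succ_mk, sum_range_succ,
      Fin.sum_univ_eq_sum_range (fun a => if a = 0 then 0 else
        ⁅genPart A ω a, letterSum A (l - a) - resPart A ω (l - a)⁆) l]
    simp only [letterSer, resSer, genSer, Prod.swap, map_sub, PowerSeries.coeff_mk, Nat.sub_self,
      resPart_zero, letterSum]
    simp only [zero_ne_one, if_false, sub_zero, mul_zero, zero_mul, add_zero]
    refine sum_congr rfl fun a _ => ?_
    by_cases h : a = 0
    · simp [h, genPart_zero]
    · rw [if_neg h, Ring.lie_def]
  rw [map_sub _ _ (mapCoeff _ _), hsum, map_sub, coeff_euler, coeff_mapCoeff]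
  simp only [letterSer, resSer, genSer, PowerSeries.coeff_mk]
  have := homological_equation A ω l
  rw [homRhs, Nat.cast_smul_eq_nsmul] at this
  change _ = _ - weightCalc ω id _
  rw [sub_eq_iff_eq_add] at this
  rw [this]
  abel

/-- The left side solves the same linear equation `t dY/dt = GY` as the normalization, but with zero
initial value. The homological equation is what makes the remaining terms cancel. -/
theorem normSer_equation :
    mapCoeff (weightCalc ω id).toAddMonoidHom (normSer A ω) + letterSer A * normSer A ω -
      resSer A ω * normSer A ω = 0 := by
  have hN : euler (normSer A ω) = genSer A ω * normSer A ω := by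
    have := euler_flow (genSer A ω) (by simp [genSer, genPart_zero])
    simpa [genSer, normSer] using this
  have hD := mapCoeff_mul (f := (weightCalc ω id).toAddMonoidHom) (weightCalc_id_mul ω)
  have hE := euler_resSer A ω
  have hL : euler (letterSer A) = letterSer A := by
    ext l
    by_cases h : l = 1 <;> simp [letterSer, letterSum, h]
  refine eq_zero_of_euler_eq (W := genSer A ω) (by simp [genSer, genPart_zero]) ?_ ?_
  · have h1 : weightCalc ω id (1 : FA ι) = 0 := by simp [← wd_nil]
    rw [map_sub, map_add, coeff_mapCoeff]
    simp [letterSer, resSer, normSer, letterSum, resPart_zero, flowCoeff, h1]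
  · rw [euler_sub, euler_add, euler_mul, euler_mul, euler_mapCoeff, hN, hD, hL]
    have h2 : euler (resSer A ω) = letterSer A - (genSer A ω * (letterSer A - resSer A ω) -
        (letterSer A - resSer A ω) * genSer A ω -
        mapCoeff (weightCalc ω id).toAddMonoidHom (genSer A ω)) := by rw [← hE]; abel
    rw [h2]
    noncomm_ring

theorem normCoeff_equation (l : ℕ) :
    weightCalc ω id (flowCoeff (genPart A ω) l) +
      ∑ p ∈ antidiagonal l, letterSum A p.1 * flowCoeff (genPart A ω) p.2 =
      ∑ p ∈ antidiagonal l, resPart A ω p.1 * flowCoeff (genPart A ω) p.2 := by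
  have h := congrArg (PowerSeries.coeff l) (normSer_equation A ω)
  rw [map_sub, map_add, coeff_mapCoeff, PowerSeries.coeff_mul, PowerSeries.coeff_mul, map_zero,
    sub_eq_zero] at h
  simpa [normSer, letterSer, resSer] using h

theorem sum_antidiagonal_letterSum (A : Finset ι) (l : ℕ) (Θ : ℕ → FA ι) :
    ∑ p ∈ antidiagonal (l + 1), letterSum A p.1 * Θ p.2 = (∑ n ∈ A, wd [n]) * Θ l := by
  rw [Nat.sum_antidiagonal_succ, sum_eq_single (0, l)]
  · simp [letterSum]
  · rintro ⟨a, b⟩ hp hne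
    have : a ≠ 0 := by
      rintro rfl
      apply hne
      simpa using hp
    simp [letterSum, this]
  · intro h; simp at h

end NormalForm

/-! ### The universal functions of the correction -/

theorem carr_nil : carr [] = 0 := by rw [carr]

theorem carr_singleton (z : ℂ) : carr [z] = if z = 0 then 1 else 0 := by rw [carr]

theorem carr_zero_cons_cons (z : ℂ) (t : List ℂ) : carr (0 :: z :: t) = 0 := by
  rw [carr, if_pos rfl]

theorem carr_zero_cons {t : List ℂ} (ht : t ≠ []) : carr (0 :: t) = 0 := by
  obtain ⟨z, s, rfl⟩ := List.exists_cons_of_ne_nil ht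
  exact carr_zero_cons_cons z s

/-- The variance formula. -/
theorem carr_variance (z₁ z₂ : ℂ) (t : List ℂ) :
    z₁ * carr (z₁ :: z₂ :: t) + carr ((z₁ + z₂) :: t) =
      ∑ j ∈ range (t.length + 2), carr (z₁ :: (z₂ :: t).drop j) * carr ((z₂ :: t).take j) := by
  -- Here only the last splitting survives, with `carr [0] = 1`; it equals the left side. This is
  -- why the value zero in the recursion is consistent with the formula.
  by_cases hz : z₁ = 0
  · subst hz
    rw [zero_mul, zero_add, zero_add, sum_range_succ, sum_eq_zero]
    · simp [carr_singleton]
    · intro j hj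
      rw [carr_zero_cons, zero_mul]
      have := mem_range.1 hj
      simp only [ne_eq, List.drop_eq_nil_iff, List.length_cons, not_le]
      omega
  -- The splitting with empty prefix contributes nothing because `carr [] = 0`; the others are the
  -- sum in the recursion, shifted by one.
  · rw [sum_range_succ', List.take_zero, carr_nil, mul_zero, add_zero, carr, if_neg hz,
      mul_inv_cancel_left₀ hz, Fin.sum_univ_eq_sum_range
        (fun j => carr (z₁ :: t.drop j) * carr (z₂ :: t.take j))]
    simp

/-- Merging two arguments preserves the total, and a splitting distributes it over two factors, so
one factor has nonzero total. Only resonant words therefore carry a nonzero mould. -/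
theorem carr_eq_zero_of_sum_ne_zero (l : List ℂ) (h : l.sum ≠ 0) : carr l = 0 := by
  induction hn : l.length using Nat.strong_induction_on generalizing l with
  | _ n ih =>
    rcases l with _ | ⟨z₁, _ | ⟨z₂, t⟩⟩
    · exact carr_nil
    · rw [carr_singleton, if_neg (by simpa using h)]
    · by_cases hz : z₁ = 0
      · rw [hz, carr_zero_cons_cons]
      · subst hn
        rw [carr, if_neg hz, ih (t.length + 1) (by simp) _
          (by simpa [add_assoc] using h) (by simp), neg_zero, zero_add, sum_eq_zero, mul_zero]
        intro j _
        have hj := j.2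
        by_cases h1 : (z₂ :: t.take j).sum = 0
        · rw [ih (z₁ :: t.drop j).length (by simp) _ _ rfl, zero_mul]
          intro h2
          apply h
          have := List.sum_take_add_sum_drop t j
          simp only [List.sum_cons] at h1 h2 ⊢
          linear_combination h1 + h2 - this
        · rw [ih (z₂ :: t.take j).length (by simp) _ h1 rfl, mul_zero]

/-! ### Words over a finite alphabet -/

section Words

variable {ι : Type*} [DecidableEq ι] (A : Finset ι)

/-- The words of length `l` over an alphabet. -/
def wordsOver (l : ℕ) : Finset (List ι) := (Fintype.piFinset fun _ : Fin l => A).image List.ofFn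

variable {A}

theorem mem_wordsOver {l : ℕ} {w : List ι} :
    w ∈ wordsOver A l ↔ w.length = l ∧ ∀ n ∈ w, n ∈ A := by
  simp only [wordsOver, mem_image, Fintype.mem_piFinset]
  constructor
  · rintro ⟨f, hf, rfl⟩
    refine ⟨List.length_ofFn, fun n hn => ?_⟩
    obtain ⟨i, rfl⟩ := (List.mem_ofFn' _ _).1 hn
    exact hf i
  · rintro ⟨rfl, h⟩
    exact ⟨w.get, fun i => h _ (List.get_mem _ _), List.ofFn_get w⟩

variable {M : Type*} [AddCommMonoid M]

theorem sum_wordsOver_zero (f : List ι → M) : ∑ w ∈ wordsOver A 0, f w = f [] := by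
  have : wordsOver A 0 = {[]} := by
    ext w
    rw [mem_wordsOver, List.length_eq_zero_iff, mem_singleton]
    exact ⟨fun h => h.1, fun h => by simp [h]⟩
  rw [this, sum_singleton]

theorem sum_wordsOver_append (k l : ℕ) (f : List ι → M) :
    ∑ w ∈ wordsOver A (k + l), f w = ∑ u ∈ wordsOver A k, ∑ v ∈ wordsOver A l, f (u ++ v) := by
  rw [← sum_product']
  refine sum_nbij' (fun w => (w.take k, w.drop k)) (fun p => p.1 ++ p.2) ?_ ?_ ?_ ?_ ?_
  · intro w hw
    obtain ⟨h1, h2⟩ := mem_wordsOver.1 hw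
    simp only [mem_product, mem_wordsOver, List.length_take, List.length_drop, h1]
    exact ⟨⟨by omega, fun n hn => h2 n (List.mem_of_mem_take hn)⟩,
      by omega, fun n hn => h2 n (List.mem_of_mem_drop hn)⟩
  · rintro ⟨u, v⟩ h
    simp only [mem_product, mem_wordsOver] at h ⊢
    refine ⟨by simp [h.1.1, h.2.1], fun n hn => ?_⟩
    rcases List.mem_append.1 hn with hn | hn
    exacts [h.1.2 n hn, h.2.2 n hn]
  · intro w _
    exact List.take_append_drop k w
  · rintro ⟨u, v⟩ h
    simp only [mem_product, mem_wordsOver] at h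
    simp [← h.1.1]
  · intro w _
    simp

theorem sum_wordsOver_one (f : List ι → M) : ∑ w ∈ wordsOver A 1, f w = ∑ n ∈ A, f [n] := by
  symm
  refine sum_bij (fun n _ => [n]) ?_ ?_ ?_ ?_
  · intro n hn; rw [mem_wordsOver]; simpa using hn
  · intro a _ b _ h; simpa using h
  · intro w hw
    obtain ⟨h1, h2⟩ := mem_wordsOver.1 hw
    obtain ⟨n, rfl⟩ := List.length_eq_one_iff.1 h1
    exact ⟨n, h2 n (by simp), rfl⟩
  · intro _ _; rfl

theorem sum_wordsOver_reverse (l : ℕ) (f : List ι → M) :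
    ∑ w ∈ wordsOver A l, f w.reverse = ∑ w ∈ wordsOver A l, f w := by
  refine sum_nbij' List.reverse List.reverse ?_ ?_ ?_ ?_ ?_
  all_goals intro w hw
  · simpa [mem_wordsOver] using hw
  · simpa [mem_wordsOver] using hw
  · simp
  · simp
  · rfl

end Words

/-! ### The variance operators -/

section Variance

variable {ι : Type*}

/-- The mould of the correction for letters of weights `ω`. -/
def mouldOf (ω : ι → ℂ) (w : List ι) : ℂ := carr (w.map ω).reverse

theorem wt_eq_zero_of_mouldOf_ne_zero {ω : ι → ℂ} {w : List ι} (h : mouldOf ω w ≠ 0) : wt ω w = 0 := by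
  by_contra hw
  refine h (carr_eq_zero_of_sum_ne_zero _ ?_)
  rwa [List.sum_reverse]

variable [DecidableEq ι] (A : Finset ι) (ω : ι → ℂ)

/-- The words of length `l` weighted by the mould. -/
def mouldSum (l : ℕ) : FA ι := ∑ w ∈ wordsOver A l, mouldOf ω w • wd w

/-- The words of length `l` weighted by the universal functions with first argument `z`. -/
def varianceSum (z : ℂ) (l : ℕ) : FA ι :=
  ∑ w ∈ wordsOver A l, carr (z :: (w.map ω).reverse) • wd w

/-- The operator that multiplies a word of weight `z` by `varianceSum z l`. -/
def varianceOp (l : ℕ) : FA ι →ₗ[ℂ] FA ι := onWords fun w => varianceSum A ω (wt ω w) l * wd w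

theorem mouldSum_zero : mouldSum A ω 0 = 0 := by
  simp [mouldSum, sum_wordsOver_zero, mouldOf, carr_nil]

theorem varianceSum_zero (z : ℂ) : varianceSum A ω z 0 = (if z = 0 then 1 else 0 : ℂ) • 1 := by
  simp only [varianceSum, sum_wordsOver_zero, List.map_nil, List.reverse_nil, carr_singleton,
    wd_nil]

/-- This is the scalar variance formula summed over words with the last letter `n` split off.
Because of the reversal, `n` supplies the second argument of `carr`. -/
theorem varianceSum_formula (z : ℂ) (l : ℕ) :
    z • varianceSum A ω z (l + 1) + ∑ n ∈ A, varianceSum A ω (z + ω n) l * wd [n] =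
      ∑ k ∈ range (l + 2), varianceSum A ω z (l + 1 - k) * mouldSum A ω k := by
  have h1 : z • varianceSum A ω z (l + 1) = ∑ n ∈ A, ∑ v ∈ wordsOver A l,
      (z * carr (z :: ω n :: v.map ω)) • wd (n :: v).reverse := by
    rw [varianceSum, ← sum_wordsOver_reverse, add_comm l 1, sum_wordsOver_append, smul_sum,
      sum_wordsOver_one]
    simp [smul_sum, smul_smul, List.map_reverse]
  have h2 : ∑ n ∈ A, varianceSum A ω (z + ω n) l * wd [n] = ∑ n ∈ A, ∑ v ∈ wordsOver A l,
      carr ((z + ω n) :: v.map ω) • wd (n :: v).reverse := by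
    refine sum_congr rfl fun n _ => ?_
    rw [varianceSum, ← sum_wordsOver_reverse, sum_mul]
    simp [wd_mul_wd, List.map_reverse]
  -- Reversal exchanges the two blocks: the first `k` weights come from the final `k` letters, so
  -- the mould factor stands on the right.
  have h3 : ∀ k ∈ range (l + 2), varianceSum A ω z (l + 1 - k) * mouldSum A ω k =
      ∑ n ∈ A, ∑ v ∈ wordsOver A l, (carr (z :: ((n :: v).map ω).drop k) *
        carr (((n :: v).map ω).take k)) • wd (n :: v).reverse := by
    intro k hk
    have hk' : k + (l + 1 - k) = 1 + l := by have := mem_range.1 hk; omega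
    have e : ∑ n ∈ A, ∑ v ∈ wordsOver A l, (carr (z :: ((n :: v).map ω).drop k) *
        carr (((n :: v).map ω).take k)) • wd (n :: v).reverse = ∑ w ∈ wordsOver A (1 + l),
        (carr (z :: (w.map ω).drop k) * carr ((w.map ω).take k)) • wd w.reverse := by
      rw [sum_wordsOver_append, sum_wordsOver_one]
      rfl
    rw [e, ← hk', sum_wordsOver_append, varianceSum, mouldSum, ← sum_wordsOver_reverse,
      ← sum_wordsOver_reverse (l := k), sum_mul_sum, sum_comm]
    refine sum_congr rfl fun u hu => sum_congr rfl fun v hv => ?_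
    obtain ⟨rfl, -⟩ := mem_wordsOver.1 hu
    have hl : u.length = (u.map ω).length := by simp
    rw [List.map_append, List.drop_left' hl.symm, List.take_left' hl.symm, smul_mul_smul_comm,
      wd_mul_wd, mouldOf, List.reverse_append]
    simp [List.map_reverse]
  rw [h1, h2, sum_congr rfl h3, sum_comm (s := range (l + 2)), ← sum_add_distrib]
  refine sum_congr rfl fun n _ => ?_
  rw [sum_comm (s := range (l + 2)), ← sum_add_distrib]
  refine sum_congr rfl fun v hv => ?_
  obtain ⟨rfl, -⟩ := mem_wordsOver.1 hv
  have := carr_variance z (ω n) (v.map ω)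
  rw [List.length_map] at this
  rw [← add_smul, this, ← sum_smul, List.map_cons]

/-- A letter on the left shifts the weight at which the variance sum is evaluated, whereas the mould
sum contains only words of weight zero and leaves it unchanged. -/
theorem varianceOp_formula (l : ℕ) (F : FA ι) :
    varianceOp A ω (l + 1) (weightCalc ω id F) + varianceOp A ω l ((∑ n ∈ A, wd [n]) * F) =
      ∑ k ∈ range (l + 2), varianceOp A ω (l + 1 - k) (mouldSum A ω k * F) := by
  suffices h : varianceOp A ω (l + 1) ∘ₗ weightCalc ω id +
      varianceOp A ω l ∘ₗ LinearMap.mulLeft ℂ (∑ n ∈ A, wd [n]) =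
      ∑ k ∈ range (l + 2), varianceOp A ω (l + 1 - k) ∘ₗ LinearMap.mulLeft ℂ (mouldSum A ω k) by
    simpa using LinearMap.congr_fun h F
  refine linearMap_ext_wd fun w => ?_
  have h1 : ∀ k, varianceOp A ω (l + 1 - k) (mouldSum A ω k * wd w) =
      varianceSum A ω (wt ω w) (l + 1 - k) * mouldSum A ω k * wd w := by
    intro k
    simp only [mouldSum, sum_mul, map_sum, mul_sum]
    refine sum_congr rfl fun u _ => ?_
    by_cases hu : mouldOf ω u = 0
    · simp [hu]
    · rw [smul_mul_assoc, map_smul, wd_mul_wd, varianceOp, onWords_wd, wt_append,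
        wt_eq_zero_of_mouldOf_ne_zero hu, zero_add, ← wd_mul_wd, mul_smul_comm, smul_mul_assoc,
        mul_assoc]
  have h2 : varianceOp A ω l ((∑ n ∈ A, wd [n]) * wd w) =
      (∑ n ∈ A, varianceSum A ω (wt ω w + ω n) l * wd [n]) * wd w := by
    simp only [sum_mul, map_sum]
    refine sum_congr rfl fun n _ => ?_
    rw [wd_mul_wd, varianceOp, onWords_wd, List.singleton_append, wt_cons, wd_cons, mul_assoc,
      add_comm]
  have h3 : varianceOp A ω (l + 1) (weightCalc ω id (wd w)) =
      wt ω w • varianceSum A ω (wt ω w) (l + 1) * wd w := by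
    simp [varianceOp]
  simp only [LinearMap.add_apply, LinearMap.comp_apply, LinearMap.sum_apply,
    LinearMap.mulLeft_apply]
  rw [h2, h3, sum_congr rfl fun k _ => h1 k, ← sum_mul, ← varianceSum_formula, add_mul]

theorem varianceOp_zero (F : FA ι) :
    varianceOp A ω 0 F = weightCalc ω (fun z => if z = 0 then 1 else 0) F := by
  refine eq_of_wd (fun w => ?_) F
  simp [varianceOp, varianceSum_zero]

theorem weightCalc_mouldSum (l : ℕ) :
    weightCalc ω (fun z => if z = 0 then 1 else 0) (mouldSum A ω l) = mouldSum A ω l := by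
  rw [mouldSum, map_sum]
  refine sum_congr rfl fun w _ => ?_
  by_cases h : mouldOf ω w = 0
  · simp [h]
  · simp [wt_eq_zero_of_mouldOf_ne_zero h]

/-- The resonant part is given by the mould of the correction. -/
theorem resPart_eq_mouldSum (l : ℕ) : resPart A ω l = mouldSum A ω l := by
  induction l using Nat.strong_induction_on with
  | _ l ih =>
    rcases l with _ | l
    · rw [resPart_zero, mouldSum_zero]
    set Θ := flowCoeff (genPart A ω) with hΘ
    have hΘ0 : Θ 0 = 1 := by rw [hΘ, flowCoeff]
    have hd0 : weightCalc ω id (Θ 0) = 0 := by simp [hΘ0, ← wd_nil]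
    -- Both sides compute the part of length `l + 1` of `V(DΘ + LΘ)`: the left by the variance
    -- formula, the right by the equation of the normalization.
    have key : ∑ b ∈ range (l + 1), ∑ k ∈ range (l + 1 - b + 1),
        varianceOp A ω (l + 1 - b - k) (mouldSum A ω k * Θ b) =
        ∑ c ∈ range (l + 2), ∑ k ∈ range (c + 1),
          varianceOp A ω (l + 1 - c) (resPart A ω k * Θ (c - k)) := by
      have h1 : ∀ c ∈ range (l + 2), ∑ k ∈ range (c + 1),
          varianceOp A ω (l + 1 - c) (resPart A ω k * Θ (c - k)) =
          varianceOp A ω (l + 1 - c) (weightCalc ω id (Θ c)) +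
            varianceOp A ω (l + 1 - c)
              (∑ p ∈ antidiagonal c, letterSum A p.1 * Θ p.2) := by
        intro c _
        rw [← map_add, normCoeff_equation, Nat.sum_antidiagonal_eq_sum_range_succ_mk, map_sum]
      rw [sum_congr rfl h1, sum_add_distrib, sum_range_succ (fun c =>
        varianceOp A ω (l + 1 - c) (weightCalc ω id (Θ c))), sum_range_succ' (fun c =>
        varianceOp A ω (l + 1 - c) (∑ p ∈ antidiagonal c, letterSum A p.1 * Θ p.2))]
      -- The one term not covered by the variance formula: the length-zero variance operator keeps
      -- weight zero only, where the weight derivation vanishes.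
      have h2 : varianceOp A ω (l + 1 - (l + 1)) (weightCalc ω id (Θ (l + 1))) = 0 := by
        rw [Nat.sub_self, varianceOp_zero, weightCalc_comp, ← weightCalc_zero ω (Θ (l + 1))]
        congr 2
        funext z
        split_ifs with h <;> simp [h]
      rw [h2, add_zero]
      have h0 : ∑ p ∈ antidiagonal 0, letterSum A p.1 * Θ p.2 = 0 := by simp [letterSum]
      rw [h0, map_zero, add_zero, ← sum_add_distrib]
      refine sum_congr rfl fun b hb => ?_
      have hb' := mem_range.1 hb
      rw [sum_antidiagonal_letterSum, show l + 1 - (b + 1) = l - b by omega, show l + 1 - b = l - b + 1 by omega,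
        varianceOp_formula]
    have hl : ∑ b ∈ range (l + 1), ∑ k ∈ range (l + 1 - b + 1),
        varianceOp A ω (l + 1 - b - k) (mouldSum A ω k * Θ b) =
        ∑ c ∈ range (l + 2), ∑ k ∈ range (c + 1),
          varianceOp A ω (l + 1 - c) (mouldSum A ω k * Θ (c - k)) := by
      -- The added term `b = l + 1` contains only the mould sum of length zero, which is zero; the
      -- index set then becomes a full triangle, reindexed by `c = b + k`.
      have h4 : ∑ b ∈ range (l + 1), ∑ k ∈ range (l + 1 - b + 1),
          varianceOp A ω (l + 1 - b - k) (mouldSum A ω k * Θ b) =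
          ∑ b ∈ range (l + 2), ∑ k ∈ range (l + 1 - b + 1),
          varianceOp A ω (l + 1 - b - k) (mouldSum A ω k * Θ b) := by
        rw [sum_range_succ _ (l + 1)]
        simp [mouldSum_zero]
      rw [h4, sum_sigma', sum_sigma']
      refine sum_nbij' (fun p => ⟨p.1 + p.2, p.2⟩) (fun p => ⟨p.1 - p.2, p.2⟩) ?_ ?_ ?_ ?_ ?_
      all_goals rintro ⟨b, k⟩ hp
      all_goals simp only [mem_sigma, mem_range] at hp ⊢
      · omega
      · omega
      · simp
      · simp only [Sigma.mk.injEq, heq_eq_eq, and_true]; omega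
      · rw [Nat.add_sub_cancel, Nat.sub_sub]
    -- The only occurrence of `S (l + 1)` is isolated. All other terms involve `S k` with `k ≤ l`
    -- and agree by the induction hypothesis.
    have split : ∀ S : ℕ → FA ι, ∑ c ∈ range (l + 2), ∑ k ∈ range (c + 1),
        varianceOp A ω (l + 1 - c) (S k * Θ (c - k)) =
        ∑ c ∈ range (l + 1), ∑ k ∈ range (c + 1), varianceOp A ω (l + 1 - c) (S k * Θ (c - k)) +
        (∑ k ∈ range (l + 1), varianceOp A ω 0 (S k * Θ (l + 1 - k)) +
          varianceOp A ω 0 (S (l + 1))) := by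
      intro S
      rw [sum_range_succ _ (l + 1), sum_range_succ (fun k =>
        varianceOp A ω (l + 1 - (l + 1)) (S k * Θ (l + 1 - k))), Nat.sub_self, hΘ0, mul_one]
    rw [hl, split, split] at key
    have e1 : ∑ c ∈ range (l + 1), ∑ k ∈ range (c + 1),
        varianceOp A ω (l + 1 - c) (mouldSum A ω k * Θ (c - k)) = ∑ c ∈ range (l + 1),
        ∑ k ∈ range (c + 1), varianceOp A ω (l + 1 - c) (resPart A ω k * Θ (c - k)) := by
      refine sum_congr rfl fun c hc => sum_congr rfl fun k hk => ?_
      rw [ih k (by have := mem_range.1 hc; have := mem_range.1 hk; omega)]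
    have e2 : ∑ k ∈ range (l + 1), varianceOp A ω 0 (mouldSum A ω k * Θ (l + 1 - k)) =
        ∑ k ∈ range (l + 1), varianceOp A ω 0 (resPart A ω k * Θ (l + 1 - k)) :=
      sum_congr rfl fun k hk => by rw [ih k (mem_range.1 hk)]
    rw [e1, e2, add_right_inj, add_right_inj, varianceOp_zero, varianceOp_zero,
      weightCalc_mouldSum, weightCalc_resPart] at key
    exact key.symm

end Variance

/-! ### Dynkin's theorem for the mould sum, separated by depth -/

section DynkinGraded

variable {ι G : Type*} [DecidableEq ι] [AddCommMonoid G] [DecidableEq G]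

/-- The mould sum is the resonant part, hence a Lie element. Nested commutators are homogeneous for
any additive grading `δ` of the letters, so the Dynkin identity can be projected onto one degree. -/
theorem dynkin_mouldSum (A : Finset ι) (ω : ι → ℂ) (δ : ι → G) (q : G) (l : ℕ) :
    ∑ w ∈ wordsOver A l with wt δ w = q, mouldOf ω w • nest w =
      (l : ℂ) • ∑ w ∈ wordsOver A l with wt δ w = q, mouldOf ω w • wd w := by
  have h := dynkin_of_mem_lieSpan (resPart_mem_lieSpan A ω l)
  rw [resPart_eq_mouldSum] at h
  have h' := congrArg (weightCalc δ fun g => if g = q then 1 else 0) h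
  simp only [mouldSum, dynkin, map_sum, map_smul, onWords_wd, weightCalc_nest, weightCalc_wd] at h'
  rw [sum_filter, sum_filter]
  refine Eq.trans (sum_congr rfl fun w _ => ?_) (h'.trans ?_)
  · split_ifs <;> simp
  · congr 1
    refine sum_congr rfl fun w _ => ?_
    split_ifs <;> simp

end DynkinGraded

/-! ### The order filtration on power series -/

/-- The series without terms of degree less than `k`. -/
def ordGE (k : ℕ) : Submodule ℂ Ser where
  carrier := {f | ∀ m : Fin 2 →₀ ℕ, m.degree < k → MvPowerSeries.coeff m f = 0}
  add_mem' hf hg m hm := by rw [map_add, hf m hm, hg m hm, add_zero]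
  zero_mem' m _ := map_zero _
  smul_mem' c f hf m hm := by rw [map_smul, hf m hm, smul_zero]

theorem mem_ordGE_iff_order {k : ℕ} {f : Ser} : f ∈ ordGE k ↔ (k : ℕ∞) ≤ f.order := by
  constructor
  · intro h
    exact MvPowerSeries.nat_le_order h
  · intro h m hm
    exact MvPowerSeries.coeff_of_lt_order (lt_of_lt_of_le (by exact_mod_cast hm) h)

theorem mem_ordGE_zero (f : Ser) : f ∈ ordGE 0 := fun _ h => absurd h (Nat.not_lt_zero _)

theorem ordGE_mono {k l : ℕ} (h : k ≤ l) {f : Ser} (hf : f ∈ ordGE l) : f ∈ ordGE k :=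
  fun m hm => hf m (hm.trans_le h)

theorem mul_mem_ordGE {k l : ℕ} {f g : Ser} (hf : f ∈ ordGE k) (hg : g ∈ ordGE l) :
    f * g ∈ ordGE (k + l) := by
  rw [mem_ordGE_iff_order] at *
  push_cast
  exact (add_le_add hf hg).trans MvPowerSeries.le_order_mul

theorem mul_mem_ordGE_right {k : ℕ} (f : Ser) {g : Ser} (hg : g ∈ ordGE k) : f * g ∈ ordGE k := by
  simpa using mul_mem_ordGE (mem_ordGE_zero f) hg

theorem X_mem_ordGE (i : Fin 2) : (MvPowerSeries.X i : Ser) ∈ ordGE 1 := by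
  intro m hm
  have : m = 0 := by rw [← Finsupp.degree_eq_zero_iff]; omega
  subst this
  exact MvPowerSeries.coeff_zero_X i

theorem eq_of_forall_sub_mem_ordGE {f g : Ser} (h : ∀ N, f - g ∈ ordGE (N + 1)) : f = g := by
  ext m
  have := h m.degree m (Nat.lt_succ_self _)
  rwa [map_sub, sub_eq_zero] at this

/-- The quotient of `f` by `x`. -/
def quotX (f : Ser) : Ser := fun m => MvPowerSeries.coeff (m + Finsupp.single 0 1) f

/-- The quotient by `y` of the part of `f` that does not contain `x`. -/
def quotY (f : Ser) : Ser := fun m =>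
  if m 0 = 0 then MvPowerSeries.coeff (m + Finsupp.single 1 1) f else 0

theorem coeff_quotX (f : Ser) (m : Fin 2 →₀ ℕ) :
    MvPowerSeries.coeff m (quotX f) = MvPowerSeries.coeff (m + Finsupp.single 0 1) f := rfl

theorem coeff_quotY (f : Ser) (m : Fin 2 →₀ ℕ) : MvPowerSeries.coeff m (quotY f) =
    if m 0 = 0 then MvPowerSeries.coeff (m + Finsupp.single 1 1) f else 0 := rfl

theorem quotX_mem {k : ℕ} {f : Ser} (hf : f ∈ ordGE (k + 1)) : quotX f ∈ ordGE k := by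
  intro m hm
  rw [coeff_quotX]
  exact hf _ (by simp; omega)

theorem quotY_mem {k : ℕ} {f : Ser} (hf : f ∈ ordGE (k + 1)) : quotY f ∈ ordGE k := by
  intro m hm
  rw [coeff_quotY]
  split_ifs
  · exact hf _ (by simp; omega)
  · rfl

theorem coeff_X_mul (i : Fin 2) (f : Ser) (m : Fin 2 →₀ ℕ) :
    MvPowerSeries.coeff m (MvPowerSeries.X i * f) =
      if 1 ≤ m i then MvPowerSeries.coeff (m - Finsupp.single i 1) f else 0 := by
  rw [MvPowerSeries.X, MvPowerSeries.coeff_monomial_mul, one_mul]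
  simp only [Finsupp.single_le_iff]

/-- Each nonconstant monomial is assigned to `x` if `x` divides it, and to `y` otherwise. This gives
algebraic control of derivations, which are not assumed continuous. -/
theorem eq_cst_add_mul (f : Ser) :
    f = cst (MvPowerSeries.coeff 0 f) + (sx * quotX f + sy * quotY f) := by
  ext m
  rw [map_add, map_add, coeff_X_mul, coeff_X_mul, coeff_quotX, coeff_quotY, MvPowerSeries.coeff_C]
  by_cases h0 : 1 ≤ m 0
  · have hm : m ≠ 0 := by rintro rfl; simp at h0
    have hm1 : (m - Finsupp.single 1 1 : Fin 2 →₀ ℕ) 0 ≠ 0 := by simp; omega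
    rw [if_pos h0, if_neg hm, if_neg hm1, tsub_add_cancel_of_le (by simpa using h0)]
    simp
  · have h0' : m 0 = 0 := by omega
    by_cases h1 : 1 ≤ m 1
    · have hm : m ≠ 0 := by rintro rfl; simp at h1
      rw [if_neg h0, if_neg hm, if_pos h1, tsub_add_cancel_of_le (by simpa using h1)]
      simp [h0']
    · have hm : m = 0 := by
        ext i
        fin_cases i
        · simpa using h0'
        · simp only [not_le, Nat.lt_one_iff] at h1; simpa using h1
      subst hm
      simp

/-! ### Derivations of the power series -/

theorem derivation_apply_eq (D : VF) (f : Ser) :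
    D f = quotX f * D sx + quotY f * D sy + (sx * D (quotX f) + sy * D (quotY f)) := by
  conv_lhs => rw [eq_cst_add_mul f]
  have : D (cst (MvPowerSeries.coeff 0 f)) = 0 := D.map_algebraMap _
  rw [map_add, map_add, this, Derivation.leibniz, Derivation.leibniz]
  simp only [smul_eq_mul]
  ring

/-- Iterating the decomposition puts `D f` in every step of the order filtration. A derivation is
thus determined by its values on the two coordinates. -/
theorem derivation_eq_zero {D : VF} (hx : D sx = 0) (hy : D sy = 0) : D = 0 := by
  ext1 f
  refine eq_of_forall_sub_mem_ordGE fun N => ?_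
  rw [Derivation.coe_zero, Pi.zero_apply, sub_zero]
  generalize N + 1 = k
  induction k generalizing f with
  | zero => exact mem_ordGE_zero _
  | succ k ih =>
    rw [derivation_apply_eq, hx, hy, mul_zero, mul_zero, add_zero, zero_add, add_comm k]
    exact add_mem (mul_mem_ordGE (X_mem_ordGE 0) (ih _)) (mul_mem_ordGE (X_mem_ordGE 1) (ih _))

theorem derivation_ext {D E : VF} (hx : D sx = E sx) (hy : D sy = E sy) : D = E := by
  rw [← sub_eq_zero]
  apply derivation_eq_zero <;> simp [hx, hy]

@[simp] theorem vf_sx (a b : Ser) : vf a b sx = a := by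
  simp [vf, MvPowerSeries.pderiv_X_self, MvPowerSeries.pderiv_X_of_ne]

@[simp] theorem vf_sy (a b : Ser) : vf a b sy = b := by
  simp [vf, MvPowerSeries.pderiv_X_self, MvPowerSeries.pderiv_X_of_ne]

/-! ### Operators that raise the order -/

/-- The operators that raise the order by at least `j`. -/
def raising (j : ℕ) : Submodule ℂ (Module.End ℂ Ser) where
  carrier := {T | ∀ k, ∀ f ∈ ordGE k, T f ∈ ordGE (k + j)}
  add_mem' hS hT k f hf := add_mem (hS k f hf) (hT k f hf)
  zero_mem' _ _ _ := zero_mem _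
  smul_mem' c _ hT k f hf := Submodule.smul_mem _ c (hT k f hf)

theorem raising_mono {i j : ℕ} (h : i ≤ j) {T : Module.End ℂ Ser} (hT : T ∈ raising j) :
    T ∈ raising i := fun k f hf => ordGE_mono (by omega) (hT k f hf)

theorem mul_mem_raising {i j : ℕ} {S T : Module.End ℂ Ser} (hS : S ∈ raising i)
    (hT : T ∈ raising j) : S * T ∈ raising (i + j) := by
  intro k f hf
  have := hS _ _ (hT k f hf)
  rwa [show k + j + i = k + (i + j) by ring] at this

theorem one_mem_raising : (1 : Module.End ℂ Ser) ∈ raising 0 := fun _ _ hf => hf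

theorem derivation_mem_raising {D : VF} {j : ℕ} (hx : D sx ∈ ordGE (1 + j))
    (hy : D sy ∈ ordGE (1 + j)) : ((D : VF) : Ser →ₗ[ℂ] Ser) ∈ raising j := by
  intro k
  change ∀ f ∈ ordGE k, D f ∈ ordGE (k + j)
  have step : ∀ k, (∀ f ∈ ordGE k, D f ∈ ordGE (k + j)) →
      ∀ f : Ser, quotX f ∈ ordGE k → quotY f ∈ ordGE k → D f ∈ ordGE (k + 1 + j) := by
    intro k ih f h1 h2
    rw [derivation_apply_eq]
    refine add_mem (add_mem ?_ ?_) (add_mem ?_ ?_)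
    · rw [show k + 1 + j = k + (1 + j) by ring]; exact mul_mem_ordGE h1 hx
    · rw [show k + 1 + j = k + (1 + j) by ring]; exact mul_mem_ordGE h2 hy
    · rw [show k + 1 + j = 1 + (k + j) by ring]; exact mul_mem_ordGE (X_mem_ordGE 0) (ih _ h1)
    · rw [show k + 1 + j = 1 + (k + j) by ring]; exact mul_mem_ordGE (X_mem_ordGE 1) (ih _ h2)
  -- The base case needs its own induction: even for `f` of order zero, the decomposition has to be
  -- applied repeatedly to reach order `j`.
  have h0 : ∀ l ≤ j, ∀ f : Ser, D f ∈ ordGE l := by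
    intro l
    induction l with
    | zero => exact fun _ f => mem_ordGE_zero _
    | succ l ih =>
      intro hl f
      rw [derivation_apply_eq]
      refine add_mem (add_mem ?_ ?_) (add_mem ?_ ?_)
      · exact mul_mem_ordGE_right _ (ordGE_mono (by omega) hx)
      · exact mul_mem_ordGE_right _ (ordGE_mono (by omega) hy)
      · rw [add_comm]; exact mul_mem_ordGE (X_mem_ordGE 0) (ih (by omega) _)
      · rw [add_comm]; exact mul_mem_ordGE (X_mem_ordGE 1) (ih (by omega) _)
  induction k with
  | zero => intro f _; rw [zero_add]; exact h0 j le_rfl f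
  | succ k ih => intro f hf; exact step k ih f (quotX_mem hf) (quotY_mem hf)

/-! ### Convergent sums of power series -/

/-- The sum of a sequence of series of increasing order. -/
def sumSer (F : ℕ → Ser) : Ser := fun m =>
  ∑ l ∈ range (m.degree + 1), MvPowerSeries.coeff m (F l)

theorem coeff_sumSer (F : ℕ → Ser) (m : Fin 2 →₀ ℕ) : MvPowerSeries.coeff m (sumSer F) =
    ∑ l ∈ range (m.degree + 1), MvPowerSeries.coeff m (F l) := rfl

theorem sumSer_sub_mem {F : ℕ → Ser} (hF : ∀ l, F l ∈ ordGE l) (N : ℕ) :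
    sumSer F - ∑ l ∈ range (N + 1), F l ∈ ordGE (N + 1) := by
  intro m hm
  rw [map_sub, coeff_sumSer, map_sum, sub_eq_zero]
  refine sum_subset (range_subset_range.2 (by omega)) fun l _ hl => hF l m ?_
  simpa using hl

theorem eq_sumSer {F : ℕ → Ser} (hF : ∀ l, F l ∈ ordGE l) {g : Ser}
    (h : ∀ N, g - ∑ l ∈ range (N + 1), F l ∈ ordGE (N + 1)) : g = sumSer F := by
  refine eq_of_forall_sub_mem_ordGE fun N => ?_
  have := sub_mem (h N) (sumSer_sub_mem hF N)
  rwa [sub_sub_sub_cancel_right] at this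

theorem sumSer_mem {F : ℕ → Ser} {k : ℕ} (h : ∀ l, F l ∈ ordGE k) : sumSer F ∈ ordGE k := by
  intro m hm
  rw [coeff_sumSer]
  exact sum_eq_zero fun l _ => h l m hm

/-- The square of indices minus the triangle below the antidiagonal leaves only pairs with `a + b >
N`. This is the error estimate behind both product formulas for convergent sums. -/
theorem sum_sum_sub_mem {M : Type*} [AddCommGroup M] [Module ℂ M] (S : Submodule ℂ M) (N : ℕ)
    (f : ℕ → ℕ → M) (h : ∀ a b, N < a + b → f a b ∈ S) :
    ∑ a ∈ range (N + 1), ∑ b ∈ range (N + 1), f a b -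
      ∑ l ∈ range (N + 1), ∑ p ∈ antidiagonal l, f p.1 p.2 ∈ S := by
  have h1 : ∑ l ∈ range (N + 1), ∑ p ∈ antidiagonal l, f p.1 p.2 =
      ∑ a ∈ range (N + 1), ∑ b ∈ range (N + 1), if a + b ≤ N then f a b else 0 := by
    rw [← sum_product', ← sum_filter, sum_sigma']
    refine sum_nbij' (fun x => x.2) (fun p => ⟨p.1 + p.2, p⟩) ?_ ?_ ?_ ?_ ?_
    · rintro ⟨l, a, b⟩ h
      simp only [mem_sigma, mem_range, HasAntidiagonal.mem_antidiagonal, mem_filter, mem_product] at h ⊢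
      omega
    · rintro ⟨a, b⟩ h
      simp only [mem_sigma, mem_range, HasAntidiagonal.mem_antidiagonal, mem_filter, mem_product,
        and_true] at h ⊢
      omega
    · rintro ⟨l, a, b⟩ h
      simp only [mem_sigma, HasAntidiagonal.mem_antidiagonal] at h
      simp [h.2]
    · intro _ _; rfl
    · intro _ _; rfl
  rw [h1, ← sum_sub_distrib]
  refine sum_mem fun a _ => ?_
  rw [← sum_sub_distrib]
  refine sum_mem fun b _ => ?_
  split_ifs with hab
  · simp
  · rw [sub_zero]; exact h a b (by omega)

theorem sumSer_mul {F H : ℕ → Ser} (hF : ∀ l, F l ∈ ordGE l) (hH : ∀ l, H l ∈ ordGE l) :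
    sumSer F * sumSer H = sumSer fun l => ∑ p ∈ antidiagonal l, F p.1 * H p.2 := by
  refine eq_sumSer (fun l => sum_mem fun p hp => ?_) fun N => ?_
  · rw [← mem_antidiagonal.1 hp]; exact mul_mem_ordGE (hF _) (hH _)
  · have h1 := mul_mem_ordGE_right (sumSer F) (sumSer_sub_mem hH N)
    have h2 := mul_mem_ordGE_right (∑ l ∈ range (N + 1), H l) (sumSer_sub_mem hF N)
    have h3 := sum_sum_sub_mem (ordGE (N + 1)) N (fun a b => F a * H b)
      fun a b hab => ordGE_mono hab (mul_mem_ordGE (hF a) (hH b))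
    rw [← sum_mul_sum] at h3
    have := add_mem (add_mem h1 h2) h3
    convert this using 1
    ring

/-! ### Evaluation of graded series of operators -/

/-- The series of operators whose term of degree `l` raises the order by at least `l`. -/
def IsGraded (T : PowerSeries (Module.End ℂ Ser)) : Prop :=
  ∀ l, PowerSeries.coeff l T ∈ raising l

theorem IsGraded.apply_mem {T : PowerSeries (Module.End ℂ Ser)} (hT : IsGraded T) (f : Ser)
    (l : ℕ) : PowerSeries.coeff l T f ∈ ordGE l := by
  simpa using hT l 0 f (mem_ordGE_zero f)

/-- The sum of the terms of a series of operators. -/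
def evalOp (T : PowerSeries (Module.End ℂ Ser)) : Module.End ℂ Ser where
  toFun f := sumSer fun l => PowerSeries.coeff l T f
  map_add' f g := by
    ext m
    simp [coeff_sumSer, sum_add_distrib]
  map_smul' c f := by
    ext m
    simp [coeff_sumSer, mul_sum]

theorem evalOp_apply (T : PowerSeries (Module.End ℂ Ser)) (f : Ser) :
    evalOp T f = sumSer fun l => PowerSeries.coeff l T f := rfl

theorem evalOp_add (S T : PowerSeries (Module.End ℂ Ser)) :
    evalOp (S + T) = evalOp S + evalOp T := by
  ext f m
  simp [evalOp_apply, coeff_sumSer, sum_add_distrib]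

theorem evalOp_sub (S T : PowerSeries (Module.End ℂ Ser)) :
    evalOp (S - T) = evalOp S - evalOp T := by
  ext f m
  simp [evalOp_apply, coeff_sumSer]

theorem evalOp_monomial {k : ℕ} {T : Module.End ℂ Ser} (hT : T ∈ raising k) :
    evalOp (PowerSeries.monomial k T) = T := by
  ext f m
  rw [evalOp_apply, coeff_sumSer, sum_eq_single k]
  · rw [PowerSeries.coeff_monomial_same]
  · intro l _ hl
    rw [PowerSeries.coeff_monomial, if_neg hl]; simp
  · intro hk
    rw [PowerSeries.coeff_monomial_same]
    exact hT 0 f (mem_ordGE_zero f) m (by simp at hk; omega)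

theorem IsGraded.mul {S T : PowerSeries (Module.End ℂ Ser)} (hS : IsGraded S) (hT : IsGraded T) :
    IsGraded (S * T) := by
  intro l
  rw [PowerSeries.coeff_mul]
  refine sum_mem fun p hp => ?_
  rw [← mem_antidiagonal.1 hp]
  exact mul_mem_raising (hS _) (hT _)

theorem evalOp_mem_raising {T : PowerSeries (Module.End ℂ Ser)} {j : ℕ}
    (hT : ∀ l, PowerSeries.coeff l T ∈ raising j) : evalOp T ∈ raising j := by
  intro k f hf
  exact sumSer_mem fun l => hT l k f hf

theorem evalOp_mul {S T : PowerSeries (Module.End ℂ Ser)} (hS : IsGraded S) (hT : IsGraded T) :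
    evalOp (S * T) = evalOp S * evalOp T := by
  refine LinearMap.ext fun f => (eq_sumSer (fun l => (hS.mul hT).apply_mem f l) fun N => ?_).symm
  -- Three errors beyond order `N`: truncating `S`, truncating `T` inside the truncated `S`, and
  -- replacing the square of indices by the triangle.
  have h1 := sumSer_sub_mem (fun l => hS.apply_mem (evalOp T f) l) N
  have h2 : ∑ a ∈ range (N + 1), PowerSeries.coeff a S
      (evalOp T f - ∑ b ∈ range (N + 1), PowerSeries.coeff b T f) ∈ ordGE (N + 1) :=
    sum_mem fun a _ => ordGE_mono (by omega) (hS a _ _ (sumSer_sub_mem (hT.apply_mem f) N))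
  have h3 := sum_sum_sub_mem (ordGE (N + 1)) N
    (fun a b => PowerSeries.coeff a S (PowerSeries.coeff b T f))
    fun a b hab => ordGE_mono (by omega) (hS a b _ (hT.apply_mem f b))
  have := add_mem (add_mem h1 h2) h3
  simp only [map_sub, map_sum, sum_sub_distrib] at this
  convert this using 1
  simp only [PowerSeries.coeff_mul, LinearMap.sum_apply, Module.End.mul_apply, evalOp_apply]
  abel

/-! ### Homogeneous vector fields with integer exponents -/

/-- The monomial `c x ^ i y ^ j`, which is zero if an exponent is negative. -/
def zmon (i j : ℤ) (c : ℂ) : Ser :=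
  if 0 ≤ i ∧ 0 ≤ j then MvPowerSeries.monomial (expo i.toNat j.toNat) c else 0

theorem expo_apply_zero (a b : ℕ) : expo a b 0 = a := by simp [expo]

theorem expo_apply_one (a b : ℕ) : expo a b 1 = b := by simp [expo]

theorem expo_eq_iff (a b : ℕ) (m : Fin 2 →₀ ℕ) : m = expo a b ↔ m 0 = a ∧ m 1 = b := by
  constructor
  · rintro rfl; exact ⟨expo_apply_zero _ _, expo_apply_one _ _⟩
  · rintro ⟨rfl, rfl⟩
    ext i
    fin_cases i
    · exact (expo_apply_zero _ _).symm
    · exact (expo_apply_one _ _).symm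

theorem degree_eq (m : Fin 2 →₀ ℕ) : m.degree = m 0 + m 1 := by
  rw [Finsupp.degree_eq_sum, Fin.sum_univ_two]

theorem coeff_zmon (i j : ℤ) (c : ℂ) (m : Fin 2 →₀ ℕ) :
    MvPowerSeries.coeff m (zmon i j c) = if (m 0 : ℤ) = i ∧ (m 1 : ℤ) = j then c else 0 := by
  classical
  unfold zmon
  by_cases h : 0 ≤ i ∧ 0 ≤ j
  · rw [if_pos h, MvPowerSeries.coeff_monomial]
    congr 1
    rw [expo_eq_iff, eq_iff_iff]
    omega
  · rw [if_neg h, if_neg (by omega), map_zero]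

theorem zmon_zero (i j : ℤ) : zmon i j 0 = 0 := by
  ext m; simp [coeff_zmon]

theorem zmon_add (i j : ℤ) (c d : ℂ) : zmon i j (c + d) = zmon i j c + zmon i j d := by
  ext m
  simp only [coeff_zmon, map_add]
  split_ifs <;> simp

theorem zmon_sub (i j : ℤ) (c d : ℂ) : zmon i j (c - d) = zmon i j c - zmon i j d := by
  ext m
  simp only [coeff_zmon, map_sub]
  split_ifs <;> simp

theorem smul_zmon (a : ℂ) (i j : ℤ) (c : ℂ) : a • zmon i j c = zmon i j (a * c) := by
  ext m
  simp [coeff_zmon]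

/-- The side conditions are essential: a negative exponent makes the left side zero, but may be
compensated in the sum of exponents on the right. -/
theorem zmon_mul {i j k l : ℤ} {c d : ℂ} (h : (0 ≤ i ∧ 0 ≤ j) ∨ c = 0)
    (h' : (0 ≤ k ∧ 0 ≤ l) ∨ d = 0) : zmon i j c * zmon k l d = zmon (i + k) (j + l) (c * d) := by
  rcases h with h | rfl
  · rcases h' with h' | rfl
    · rw [zmon, zmon, zmon, if_pos h, if_pos h', if_pos (by omega),
        MvPowerSeries.monomial_mul_monomial]
      congr 2
      rw [expo_eq_iff, Finsupp.add_apply, Finsupp.add_apply]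
      simp only [expo_apply_zero, expo_apply_one]
      omega
    · simp [zmon_zero]
  · simp [zmon_zero]

theorem pderiv_zero_zmon (i j : ℤ) (c : ℂ) :
    MvPowerSeries.pderiv ℂ (0 : Fin 2) (zmon i j c) = zmon (i - 1) j (i * c) := by
  ext m
  rw [MvPowerSeries.coeff_pderiv, coeff_zmon, coeff_zmon]
  simp only [Finsupp.add_apply, Finsupp.single_eq_same]
  rw [Finsupp.single_eq_of_ne (by decide)]
  by_cases h : (m 0 : ℤ) = i - 1 ∧ (m 1 : ℤ) = j
  · obtain ⟨h1, rfl⟩ := h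
    obtain rfl : i = m 0 + 1 := by omega
    simp [mul_comm]
  · rw [if_neg h, if_neg (by push_cast; omega), zero_mul]

theorem pderiv_one_zmon (i j : ℤ) (c : ℂ) :
    MvPowerSeries.pderiv ℂ (1 : Fin 2) (zmon i j c) = zmon i (j - 1) (j * c) := by
  ext m
  rw [MvPowerSeries.coeff_pderiv, coeff_zmon, coeff_zmon]
  simp only [Finsupp.add_apply, Finsupp.single_eq_same]
  rw [Finsupp.single_eq_of_ne (by decide)]
  by_cases h : (m 0 : ℤ) = i ∧ (m 1 : ℤ) = j - 1
  · obtain ⟨rfl, h1⟩ := h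
    obtain rfl : j = m 1 + 1 := by omega
    simp [mul_comm]
  · rw [if_neg h, if_neg (by push_cast; omega), zero_mul]

theorem cst_mul_pow_mul_pow (c : ℂ) (a b : ℕ) :
    cst c * (sx ^ a * sy ^ b) = zmon a b c := by
  rw [cst, zmon, if_pos (by omega), MvPowerSeries.X_pow_eq, MvPowerSeries.X_pow_eq,
    MvPowerSeries.monomial_mul_monomial, ← MvPowerSeries.monomial_zero_eq_C_apply,
    MvPowerSeries.monomial_mul_monomial]
  simp [expo]

/-- The vector field `x ^ s y ^ t (p x ∂x + q y ∂y)`. -/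
def homVF (s t : ℤ) (p q : ℂ) : VF := vf (zmon (s + 1) t p) (zmon s (t + 1) q)

/-- The coefficients of monomials with a negative exponent vanish. -/
def Admissible (s t : ℤ) (p q : ℂ) : Prop :=
  ((0 ≤ s + 1 ∧ 0 ≤ t) ∨ p = 0) ∧ ((0 ≤ s ∧ 0 ≤ t + 1) ∨ q = 0)

theorem vf_apply (a b f : Ser) : vf a b f =
    a * MvPowerSeries.pderiv ℂ (0 : Fin 2) f + b * MvPowerSeries.pderiv ℂ (1 : Fin 2) f := by
  simp [vf]

theorem homVF_apply_zmon {s t : ℤ} {p q : ℂ} (h : Admissible s t p q) {i j : ℤ} {c : ℂ}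
    (hc : (0 ≤ i ∧ 0 ≤ j) ∨ c = 0) :
    homVF s t p q (zmon i j c) = zmon (s + i) (t + j) ((i * p + j * q) * c) := by
  -- Differentiation can create the exponent `-1` only from exponent zero, and then the factor `i`
  -- is zero.
  have h0 : (0 ≤ i - 1 ∧ 0 ≤ j) ∨ (i : ℂ) * c = 0 := by
    rcases hc with hc | rfl
    · by_cases hi : i = 0
      · right; simp [hi]
      · left; omega
    · simp
  have h1 : (0 ≤ i ∧ 0 ≤ j - 1) ∨ (j : ℂ) * c = 0 := by
    rcases hc with hc | rfl
    · by_cases hj : j = 0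
      · right; simp [hj]
      · left; omega
    · simp
  rw [homVF, vf_apply, pderiv_zero_zmon, pderiv_one_zmon, zmon_mul h.1 h0, zmon_mul h.2 h1,
    show s + 1 + (i - 1) = s + i by ring, show t + 1 + (j - 1) = t + j by ring, ← zmon_add]
  congr 1
  ring

theorem homVF_lie {s t k l : ℤ} {a b p q : ℂ} (h : Admissible s t a b)
    (h' : Admissible k l p q) :
    ⁅homVF s t a b, homVF k l p q⁆ = homVF (s + k) (t + l)
      ((k - s) * (a * p) + l * (b * p) - t * (a * q))
      ((l - t) * (b * q) + k * (a * q) - s * (b * p)) := by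
  have hx : ∀ (i j : ℤ) (u v : ℂ), homVF i j u v sx = zmon (i + 1) j u := fun _ _ _ _ => vf_sx _ _
  have hy : ∀ (i j : ℤ) (u v : ℂ), homVF i j u v sy = zmon i (j + 1) v := fun _ _ _ _ => vf_sy _ _
  apply derivation_ext
  · rw [Derivation.commutator_apply, hx, hx, hx, homVF_apply_zmon h h'.1, homVF_apply_zmon h' h.1,
      show s + (k + 1) = s + k + 1 by ring, show k + (s + 1) = s + k + 1 by ring, add_comm l t,
      ← zmon_sub]
    congr 1
    push_cast
    ring
  · rw [Derivation.commutator_apply, hy, hy, hy, homVF_apply_zmon h h'.2, homVF_apply_zmon h' h.2,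
      show t + (l + 1) = t + l + 1 by ring, show l + (t + 1) = t + l + 1 by ring, add_comm k s,
      ← zmon_sub]
    congr 1
    push_cast
    ring

theorem smul_homVF (c : ℂ) (s t : ℤ) (p q : ℂ) :
    c • homVF s t p q = homVF s t (c * p) (c * q) := by
  apply derivation_ext <;> simp [homVF, smul_zmon]

theorem linCenter_eq : linCenter = homVF 0 0 Complex.I (-Complex.I) := by
  have h1 : cst Complex.I * sx = zmon (0 + 1) 0 Complex.I := by
    simpa using cst_mul_pow_mul_pow Complex.I 1 0
  have h2 : -(cst Complex.I * sy) = zmon 0 (0 + 1) (-Complex.I) := by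
    have := cst_mul_pow_mul_pow (-Complex.I) 0 1
    simp only [pow_zero, pow_one, one_mul, map_neg, neg_mul] at this
    simpa using this
  rw [linCenter, homVF, h1, h2]

theorem admissible_linCenter : Admissible 0 0 Complex.I (-Complex.I) := by
  constructor <;> left <;> simp

theorem lie_linCenter_homVF {s t : ℤ} {p q : ℂ} (h : Admissible s t p q) :
    ⁅linCenter, homVF s t p q⁆ = weight (s, t) • homVF s t p q := by
  rw [linCenter_eq, homVF_lie admissible_linCenter h, smul_homVF, zero_add, zero_add]
  simp only [weight]
  congr 1 <;> push_cast <;> ring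

theorem zmon_mem_ordGE {i j : ℤ} {c : ℂ} {k : ℕ} (h : (k : ℤ) ≤ i + j) : zmon i j c ∈ ordGE k := by
  intro m hm
  rw [degree_eq] at hm
  rw [coeff_zmon, if_neg (by omega)]

theorem homVF_mem_raising {s t : ℤ} {p q : ℂ} {l : ℕ} (h : (l : ℤ) ≤ s + t) :
    (homVF s t p q : Ser →ₗ[ℂ] Ser) ∈ raising l := by
  refine derivation_mem_raising ?_ ?_
  · rw [homVF, vf_sx]; exact zmon_mem_ordGE (by push_cast; omega)
  · rw [homVF, vf_sy]; exact zmon_mem_ordGE (by push_cast; omega)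

theorem homVF_diag (p : ℕ) (a b : ℂ) :
    homVF p p a b = (sx * sy) ^ p • vf (cst a * sx) (cst b * sy) := by
  have h1 : (sx * sy) ^ p * (cst a * sx) = zmon (p + 1) p a := by
    have := cst_mul_pow_mul_pow a (p + 1) p
    push_cast at this
    rw [← this]; ring
  have h2 : (sx * sy) ^ p * (cst b * sy) = zmon p (p + 1) b := by
    have := cst_mul_pow_mul_pow b p (p + 1)
    push_cast at this
    rw [← this]; ring
  apply derivation_ext
  · rw [Derivation.smul_apply, vf_sx, smul_eq_mul, h1, homVF, vf_sx]
  · rw [Derivation.smul_apply, vf_sy, smul_eq_mul, h2, homVF, vf_sy]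

/-! ### The homogeneous operators of a field -/

variable (P : MvPolynomial (Fin 2) ℂ)

theorem qc_conjSwap (n : ℤ × ℤ) : qc (conjSwap P) n = starRingEnd ℂ (pc P n.swap) := by
  unfold qc pc
  by_cases h : 0 ≤ n.1 ∧ -1 ≤ n.2
  · have h' : -1 ≤ n.swap.1 ∧ 0 ≤ n.swap.2 := by simp; omega
    rw [if_pos h, if_pos h', conjSwap]
    have e : expo n.1.toNat (n.2 + 1).toNat = Finsupp.mapDomain (Equiv.swap (0 : Fin 2) 1)
        (expo (n.swap.1 + 1).toNat n.swap.2.toNat) := by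
      simp [expo, Finsupp.mapDomain_add, Finsupp.mapDomain_single, add_comm]
    rw [e, MvPolynomial.coeff_rename_mapDomain _ (Equiv.injective _), MvPolynomial.coeff_map]
  · have h' : ¬(-1 ≤ n.swap.1 ∧ 0 ≤ n.swap.2) := by simp; omega
    rw [if_neg h, if_neg h', map_zero]

theorem pc_eq_zero {n : ℤ × ℤ} (h : ¬(0 ≤ n.1 + 1 ∧ 0 ≤ n.2)) : pc P n = 0 :=
  if_neg (by omega)

theorem qc_eq_zero {Q : MvPolynomial (Fin 2) ℂ} {n : ℤ × ℤ} (h : ¬(0 ≤ n.1 ∧ 0 ≤ n.2 + 1)) :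
    qc Q n = 0 := if_neg (by omega)

theorem admissible_opB (n : ℤ × ℤ) : Admissible n.1 n.2 (pc P n) (qc (conjSwap P) n) :=
  ⟨or_iff_not_imp_left.2 fun h => pc_eq_zero P h, or_iff_not_imp_left.2 fun h => qc_eq_zero h⟩

theorem opB_eq (n : ℤ × ℤ) : opB P n = homVF n.1 n.2 (pc P n) (qc (conjSwap P) n) := by
  rw [opB, homVF, cst_mul_pow_mul_pow, cst_mul_pow_mul_pow]
  congr 1
  · by_cases h : 0 ≤ n.1 + 1 ∧ 0 ≤ n.2
    · rw [Int.toNat_of_nonneg h.1, Int.toNat_of_nonneg h.2]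
    · rw [pc_eq_zero P h, zmon_zero, zmon_zero]
  · by_cases h : 0 ≤ n.1 ∧ 0 ≤ n.2 + 1
    · rw [Int.toNat_of_nonneg h.1, Int.toNat_of_nonneg h.2]
    · rw [qc_eq_zero h, zmon_zero, zmon_zero]

/-- The value of a polynomial in the coefficients. -/
def evalCoeff : CoeffPoly ℤ →+* ℂ := MvPolynomial.eval₂Hom (Int.castRingHom ℂ) (coeffVal P)

theorem evalCoeff_varP (n : ℤ × ℤ) : evalCoeff P (varP n) = pc P n := by
  unfold varP
  split_ifs with h
  · simp [evalCoeff, coeffVal]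
  · rw [map_zero, pc_eq_zero P (by omega)]

theorem evalCoeff_varQ (n : ℤ × ℤ) : evalCoeff P (varQ n) = qc (conjSwap P) n := by
  unfold varQ
  split_ifs with h
  · simp [evalCoeff, coeffVal, qc_conjSwap]
  · rw [map_zero, qc_eq_zero (by omega)]

@[simp] theorem size₁_cons (n : ℤ × ℤ) (w : List (ℤ × ℤ)) : size₁ (n :: w) = n.1 + size₁ w := by
  simp [size₁]

@[simp] theorem size₂_cons (n : ℤ × ℤ) (w : List (ℤ × ℤ)) : size₂ (n :: w) = n.2 + size₂ w := by
  simp [size₂]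

/-- If an exponent of the bracket is invalid, each term either has a zero coefficient or has two
valid factors, whose exponents then force its integer prefactor to vanish. -/
theorem Admissible.bracket {n : ℤ × ℤ} {s t : ℤ} {p q : ℂ} (h : Admissible s t p q) :
    Admissible (n.1 + s) (n.2 + t)
      ((s - n.1) * (pc P n * p) + t * (qc (conjSwap P) n * p) - n.2 * (pc P n * q))
      ((t - n.2) * (qc (conjSwap P) n * q) + s * (pc P n * q) -
        n.1 * (qc (conjSwap P) n * p)) := by
  obtain ⟨ha, hb⟩ := admissible_opB P n
  obtain ⟨hp, hq⟩ := h
  have key : ∀ {u : ℤ} {x y : ℂ} {X Y : Prop}, X ∨ x = 0 → Y ∨ y = 0 → (X → Y → u = 0) →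
      (u : ℂ) * (x * y) = 0 := by
    rintro u x y X Y (hX | rfl) (hY | rfl) h
    · simp [h hX hY]
    all_goals simp
  constructor
  · rw [or_iff_not_imp_left]
    intro hn
    rw [← Int.cast_sub, key ha hp (by omega), key hb hp (by omega), key ha hq (by omega)]
    ring
  · rw [or_iff_not_imp_left]
    intro hn
    rw [← Int.cast_sub, key hb hq (by omega), key ha hq (by omega), key hb hp (by omega)]
    ring

theorem nested_eq (w : List (ℤ × ℤ)) :
    nested P w = homVF (size₁ w) (size₂ w) (evalCoeff P (genPQ w).1) (evalCoeff P (genPQ w).2) ∧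
      Admissible (size₁ w) (size₂ w) (evalCoeff P (genPQ w).1) (evalCoeff P (genPQ w).2) := by
  induction w using nested.induct with
  | case1 =>
    refine ⟨?_, ?_, ?_⟩
    · apply derivation_ext <;> simp [nested, genPQ, homVF, zmon_zero]
    · right; simp [genPQ]
    · right; simp [genPQ]
  | case2 n =>
    simp only [nested, genPQ, evalCoeff_varP, evalCoeff_varQ, size₁, size₂, List.map_cons,
      List.map_nil, List.sum_cons, List.sum_nil, add_zero]
    exact ⟨opB_eq P n, admissible_opB P n⟩
  | case3 n m t ih =>
    rw [nested, ih.1, opB_eq, homVF_lie (admissible_opB P n) ih.2, size₁_cons n, size₂_cons n]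
    simp only [genPQ, map_sub, map_add, map_mul, evalCoeff_varP, evalCoeff_varQ,
      zsmul_eq_mul, map_intCast, Int.cast_sub]
    exact ⟨trivial, ih.2.bracket P⟩

theorem bracketP_eq (w : List (ℤ × ℤ)) : bracketP P w = evalCoeff P (genPQ w).1 := by
  obtain ⟨h1, h2, -⟩ := nested_eq P w
  rw [bracketP, h1, homVF, vf_sx, coeff_zmon, expo_apply_zero, expo_apply_one]
  rcases h2 with h | h
  · rw [if_pos (by omega)]
  · rw [h, ite_self]

theorem bracketQ_eq (w : List (ℤ × ℤ)) : bracketQ P w = evalCoeff P (genPQ w).2 := by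
  obtain ⟨h1, -, h2⟩ := nested_eq P w
  rw [bracketQ, h1, homVF, vf_sy, coeff_zmon, expo_apply_zero, expo_apply_one]
  rcases h2 with h | h
  · rw [if_pos (by omega)]
  · rw [h, ite_self]

theorem nested_eq_homVF (w : List (ℤ × ℤ)) :
    nested P w = homVF (size₁ w) (size₂ w) (bracketP P w) (bracketQ P w) := by
  rw [bracketP_eq, bracketQ_eq]
  exact (nested_eq P w).1

/-! ### The representation of the free algebra by differential operators -/

section EulerConj

variable {R : Type*} [Ring R]

theorem euler_C (c : R) : euler (PowerSeries.C c) = 0 := by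
  ext1 l
  rw [coeff_euler, PowerSeries.coeff_C, map_zero]
  split_ifs with h <;> simp [h]

/-- Differentiating `ΘΨ = 1` gives `t dΨ/dt = -ΨW`; the conjugate of a constant therefore evolves by
the commutator with `W`. -/
theorem euler_conj {Θ Ψ W : PowerSeries R} (h : Θ * Ψ = 1) (h' : Ψ * Θ = 1)
    (hΘ : euler Θ = W * Θ) (c : R) : euler (Θ * PowerSeries.C c * Ψ) =
      W * (Θ * PowerSeries.C c * Ψ) - Θ * PowerSeries.C c * Ψ * W := by
  have h1 : euler (Θ * Ψ) = 0 := by rw [h, ← map_one PowerSeries.C, euler_C]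
  rw [euler_mul, hΘ, mul_assoc, h, mul_one] at h1
  have h2 : euler Ψ = -(Ψ * W) := by
    have := congrArg (fun x => Ψ * x) (eq_neg_of_add_eq_zero_right h1)
    simpa only [← mul_assoc, h', one_mul, mul_neg] using this
  rw [euler_mul, euler_mul, hΘ, h2, euler_C]
  noncomm_ring

end EulerConj

section Representation

variable (P : MvPolynomial (Fin 2) ℂ) (d : ℕ)

theorem opWord_append (u v : List (ℤ × ℤ)) : opWord P (u ++ v) = opWord P u * opWord P v := by
  simp [opWord]

/-- The representation that replaces every letter by its operator. -/
def rep : FA (ℤ × ℤ) →+* Module.End ℂ Ser :=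
  { onWords (opWord P) with
    map_one' := by
      change onWords (opWord P) 1 = 1
      rw [← wd_nil, onWords_wd]; rfl
    map_mul' := fun F H => by
      change onWords (opWord P) (F * H) = onWords (opWord P) F * onWords (opWord P) H
      refine eq_of_wd (f := onWords (opWord P) ∘ₗ LinearMap.mulRight ℂ H)
        (g := LinearMap.mulRight ℂ (onWords (opWord P) H) ∘ₗ onWords (opWord P)) (fun w => ?_) F
      refine eq_of_wd (f := onWords (opWord P) ∘ₗ LinearMap.mulLeft ℂ (wd w))
        (g := LinearMap.mulLeft ℂ (onWords (opWord P) (wd w)) ∘ₗ onWords (opWord P))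
        (fun v => ?_) H
      simp [wd_mul_wd, opWord_append]
    map_zero' := map_zero (onWords (opWord P)) }

theorem rep_wd (w : List (ℤ × ℤ)) : rep P (wd w) = opWord P w := onWords_wd _ _

theorem rep_smul (c : ℂ) (F : FA (ℤ × ℤ)) : rep P (c • F) = c • rep P F :=
  map_smul (onWords (opWord P)) c F

theorem rep_letter (n : ℤ × ℤ) : rep P (wd [n]) = (opB P n : Ser →ₗ[ℂ] Ser) := by
  rw [rep_wd, opWord]; simp

theorem coe_lie (D E : VF) : ((⁅D, E⁆ : VF) : Ser →ₗ[ℂ] Ser) =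
    ((D : Ser →ₗ[ℂ] Ser) * (E : Ser →ₗ[ℂ] Ser) - (E : Ser →ₗ[ℂ] Ser) * (D : Ser →ₗ[ℂ] Ser) :
      Module.End ℂ Ser) := by
  ext1 f
  exact Derivation.commutator_apply (D1 := D) (D2 := E) f

theorem coe_sum {κ : Type*} (s : Finset κ) (D : κ → VF) :
    ((∑ i ∈ s, D i : VF) : Ser →ₗ[ℂ] Ser) = ∑ i ∈ s, (D i : Ser →ₗ[ℂ] Ser) := by
  classical
  induction s using Finset.induction_on with
  | empty => rw [sum_empty, sum_empty, Derivation.coe_zero_linearMap]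
  | insert i s hi ih => rw [sum_insert hi, sum_insert hi, Derivation.coe_add_linearMap, ih]

theorem rep_nest (w : List (ℤ × ℤ)) : rep P (nest w) = (nested P w : Ser →ₗ[ℂ] Ser) := by
  induction w using nest.induct with
  | case1 => rw [nest, map_zero, nested, Derivation.coe_zero_linearMap]
  | case2 n => rw [nest, rep_letter, nested]
  | case3 n m t ih => rw [nest, Ring.lie_def, map_sub, map_mul, map_mul, ih, rep_letter, nested,
      coe_lie]

/-- Both sides are derivations along words, and each letter is an eigenvector of the bracket with
`linCenter` for its weight. -/
theorem linCenter_mul_rep_sub (F : FA (ℤ × ℤ)) :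
    ((linCenter : Ser →ₗ[ℂ] Ser) * rep P F - rep P F * (linCenter : Ser →ₗ[ℂ] Ser) :
      Module.End ℂ Ser) = rep P (weightCalc weight id F) := by
  set Λ : Module.End ℂ Ser := (linCenter : Ser →ₗ[ℂ] Ser)
  refine eq_of_wd (f := (LinearMap.mulLeft ℂ Λ - LinearMap.mulRight ℂ Λ) ∘ₗ onWords (opWord P))
    (g := onWords (opWord P) ∘ₗ weightCalc weight id) (fun w => ?_) F
  have main : Λ * opWord P w - opWord P w * Λ = wt weight w • opWord P w := by
    induction w with
    | nil => simp [opWord]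
    | cons n w ih =>
      have h1 : opWord P (n :: w) = (opB P n : Ser →ₗ[ℂ] Ser) * opWord P w := by simp [opWord]
      have h2 : Λ * (opB P n : Ser →ₗ[ℂ] Ser) = weight n • (opB P n : Ser →ₗ[ℂ] Ser) +
          (opB P n : Ser →ₗ[ℂ] Ser) * Λ := by
        rw [← sub_eq_iff_eq_add, ← coe_lie, opB_eq, lie_linCenter_homVF (admissible_opB P n)]
        rfl
      rw [sub_eq_iff_eq_add] at ih
      rw [h1, ← mul_assoc, h2, add_mul, mul_assoc, ih, wt_cons, mul_add, add_smul, smul_mul_assoc,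
        mul_smul_comm, mul_assoc]
      abel
  simpa using main

variable {d}

theorem length_le_size {w : List (ℤ × ℤ)} (hw : ∀ n ∈ w, n ∈ alphabet d) :
    (w.length : ℤ) ≤ size₁ w + size₂ w := by
  induction w with
  | nil => simp [size₁, size₂]
  | cons n w ih =>
    have h1 := ih fun m hm => hw m (List.mem_cons_of_mem _ hm)
    have h2 := hw n (by simp)
    simp only [alphabet, mem_filter] at h2
    rw [size₁_cons, size₂_cons, List.length_cons]
    push_cast
    omega

theorem nested_mem_raising {w : List (ℤ × ℤ)} (hw : ∀ n ∈ w, n ∈ alphabet d) :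
    (nested P w : Ser →ₗ[ℂ] Ser) ∈ raising w.length := by
  rw [nested_eq_homVF]
  exact homVF_mem_raising (length_le_size hw)

/-- Brackets of vector fields are vector fields, and each letter has depth at least one, so length
bounds the gain in order from below. -/
theorem rep_mem_of_mem_lieSpan {l : ℕ} {F : FA (ℤ × ℤ)} (hF : F ∈ lieSpan (alphabet d) l) :
    ∃ D : VF, rep P F = (D : Ser →ₗ[ℂ] Ser) ∧ (D : Ser →ₗ[ℂ] Ser) ∈ raising l := by
  induction hF using Submodule.span_induction with
  | mem x hx =>
    obtain ⟨w, rfl, hw, rfl⟩ := hx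
    exact ⟨nested P w, rep_nest P w, nested_mem_raising P hw⟩
  | zero => exact ⟨0, by rw [map_zero, Derivation.coe_zero_linearMap],
      by rw [Derivation.coe_zero_linearMap]; exact zero_mem _⟩
  | add x y _ _ hx hy =>
    obtain ⟨D, hD, hD'⟩ := hx
    obtain ⟨E, hE, hE'⟩ := hy
    exact ⟨D + E, by rw [map_add, hD, hE, Derivation.coe_add_linearMap],
      by rw [Derivation.coe_add_linearMap]; exact add_mem hD' hE'⟩
  | smul a x _ hx =>
    obtain ⟨D, hD, hD'⟩ := hx
    exact ⟨a • D, by rw [rep_smul, hD, Derivation.coe_smul_linearMap],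
      by rw [Derivation.coe_smul_linearMap]; exact Submodule.smul_mem _ _ hD'⟩

/-! ### The normalization -/

variable (d)

/-- The term of length `l` of the generator of the normalization. -/
def genOp (l : ℕ) : Module.End ℂ Ser := rep P (genPart (alphabet d) weight l)

/-- The normalization as a series of operators. -/
def normOp : PowerSeries (Module.End ℂ Ser) :=
  PowerSeries.map (rep P) (normSer (alphabet d) weight)

/-- The correction as a series of operators. -/
def corrOp : PowerSeries (Module.End ℂ Ser) :=
  PowerSeries.map (rep P) (resSer (alphabet d) weight)

theorem coeff_corrOp (l : ℕ) : PowerSeries.coeff l (corrOp P d) =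
    rep P (resPart (alphabet d) weight l) := by
  simp [corrOp, resSer]

theorem genOp_zero : genOp P d 0 = 0 := by rw [genOp, genPart_zero, map_zero]

theorem exists_genOp_eq (l : ℕ) : ∃ D : VF, genOp P d l = (D : Ser →ₗ[ℂ] Ser) ∧
    (D : Ser →ₗ[ℂ] Ser) ∈ raising l :=
  rep_mem_of_mem_lieSpan P (genPart_mem_lieSpan (alphabet d) weight l)

theorem exists_corrOp_eq (l : ℕ) : ∃ D : VF,
    PowerSeries.coeff l (corrOp P d) = (D : Ser →ₗ[ℂ] Ser) ∧
    (D : Ser →ₗ[ℂ] Ser) ∈ raising l := by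
  rw [coeff_corrOp]
  exact rep_mem_of_mem_lieSpan P (resPart_mem_lieSpan (alphabet d) weight l)

theorem isGraded_corrOp : IsGraded (corrOp P d) := fun l => by
  obtain ⟨D, h1, h2⟩ := exists_corrOp_eq P d l
  rwa [h1]

theorem normOp_zero : PowerSeries.coeff 0 (normOp P d) = 1 := by
  simp [normOp, normSer, flowCoeff]

theorem euler_normOp : euler (normOp P d) = PowerSeries.mk (genOp P d) * normOp P d := by
  have h := euler_flow (genSer (alphabet d) weight) (by simp [genSer, genPart_zero])
  have h' := congrArg (PowerSeries.map (rep P)) h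
  rw [map_mul] at h'
  have e1 : PowerSeries.map (rep P) (genSer (alphabet d) weight) = PowerSeries.mk (genOp P d) := by
    ext1 l; simp [genSer, genOp]
  have e2 : PowerSeries.mk (flowCoeff fun n =>
      PowerSeries.coeff n (genSer (alphabet d) weight)) = normSer (alphabet d) weight := by
    simp [genSer, normSer]
  rw [e1, e2] at h'
  rw [normOp, ← h']
  ext1 l
  rw [coeff_euler, PowerSeries.coeff_map, PowerSeries.coeff_map, coeff_euler, map_nsmul]

theorem coeff_euler_normOp (l : ℕ) : (l : ℂ) • PowerSeries.coeff l (normOp P d) =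
    ∑ p ∈ antidiagonal l, genOp P d p.1 * PowerSeries.coeff p.2 (normOp P d) := by
  have := congrArg (PowerSeries.coeff l) (euler_normOp P d)
  rw [coeff_euler, PowerSeries.coeff_mul] at this
  simpa [Nat.cast_smul_eq_nsmul ℂ] using this

theorem eq_inv_smul_of_smul_eq {M : Type*} [AddCommGroup M] [Module ℂ M] {l : ℕ} (hl : 0 < l)
    {x y : M} (h : (l : ℂ) • x = y) : x = (l : ℂ)⁻¹ • y := by
  rw [← h, smul_smul, inv_mul_cancel₀ (Nat.cast_ne_zero.2 hl.ne'), one_smul]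

theorem coeff_normOp_eq {l : ℕ} (hl : 0 < l) : PowerSeries.coeff l (normOp P d) =
    (l : ℂ)⁻¹ • ∑ p ∈ antidiagonal l, genOp P d p.1 * PowerSeries.coeff p.2 (normOp P d) :=
  eq_inv_smul_of_smul_eq (M := Module.End ℂ Ser) hl (coeff_euler_normOp P d l)

theorem isGraded_normOp : IsGraded (normOp P d) := by
  intro l
  induction l using Nat.strong_induction_on with
  | _ l ih =>
    rcases Nat.eq_zero_or_pos l with rfl | hl
    · rw [normOp_zero]; exact one_mem_raising
    · rw [coeff_normOp_eq P d hl]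
      refine Submodule.smul_mem _ _ (sum_mem fun p hp => ?_)
      have hp' := HasAntidiagonal.mem_antidiagonal.1 hp
      rcases Nat.eq_zero_or_pos p.1 with h0 | h0
      · rw [h0, genOp_zero, zero_mul]; exact zero_mem _
      · obtain ⟨D, h1, h2⟩ := exists_genOp_eq P d p.1
        rw [← h1] at h2
        have := mul_mem_raising h2 (ih p.2 (by omega))
        rwa [hp'] at this

theorem normOp_apply_one (l : ℕ) (hl : 0 < l) : PowerSeries.coeff l (normOp P d) 1 = 0 := by
  induction l using Nat.strong_induction_on with
  | _ l ih =>
    rw [coeff_normOp_eq P d hl, LinearMap.smul_apply,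
      LinearMap.sum_apply, sum_eq_zero, smul_zero]
    intro p hp
    have hp' := HasAntidiagonal.mem_antidiagonal.1 hp
    rcases Nat.eq_zero_or_pos p.1 with h0 | h0
    · rw [h0, genOp_zero, zero_mul, LinearMap.zero_apply]
    · rw [Module.End.mul_apply]
      rcases Nat.eq_zero_or_pos p.2 with h1 | h1
      · obtain ⟨D, h2, -⟩ := exists_genOp_eq P d p.1
        rw [h1, normOp_zero, h2, Module.End.one_apply]
        exact D.map_one_eq_zero
      · rw [ih p.2 (by omega) h1, map_zero]

/-- The inverse of the normalization. -/
def normInv : PowerSeries (Module.End ℂ Ser) := PowerSeries.invOfUnit (normOp P d) 1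

theorem normOp_mul_normInv : normOp P d * normInv P d = 1 :=
  PowerSeries.mul_invOfUnit _ _ (by
    rw [← PowerSeries.coeff_zero_eq_constantCoeff_apply, normOp_zero]; rfl)

theorem normInv_mul_normOp : normInv P d * normOp P d = 1 :=
  MvPowerSeries.invOfUnit_mul _ _ (by
    change PowerSeries.constantCoeff (normOp P d) = _
    rw [← PowerSeries.coeff_zero_eq_constantCoeff_apply, normOp_zero]; rfl)

theorem isGraded_one : IsGraded 1 := by
  intro l
  rw [PowerSeries.coeff_one]
  split_ifs with h
  · rw [h]; exact one_mem_raising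
  · exact zero_mem _

theorem isGraded_normInv : IsGraded (normInv P d) := by
  intro l
  induction l using Nat.strong_induction_on with
  | _ l ih =>
    have h := congrArg (PowerSeries.coeff l) (normOp_mul_normInv P d)
    rw [PowerSeries.coeff_mul, ← add_sum_erase _ _ (a := (0, l)) (by simp), normOp_zero,
      one_mul, ← eq_sub_iff_add_eq] at h
    rw [h]
    refine sub_mem (isGraded_one l) (sum_mem fun p hp => ?_)
    obtain ⟨hne, hp⟩ := mem_erase.1 hp
    have hp' := HasAntidiagonal.mem_antidiagonal.1 hp
    have h0 : p.1 ≠ 0 := fun h0 => hne (Prod.ext h0 (by simp; omega))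
    have := mul_mem_raising (isGraded_normOp P d p.1) (ih p.2 (by omega))
    rwa [hp'] at this

/-- The conjugate of the multiplication by `f` under the normalization. -/
def conjMul (f : Ser) : PowerSeries (Module.End ℂ Ser) :=
  normOp P d * PowerSeries.C (LinearMap.mulLeft ℂ f) * normInv P d

theorem euler_conjMul (f : Ser) : euler (conjMul P d f) =
    PowerSeries.mk (genOp P d) * conjMul P d f - conjMul P d f * PowerSeries.mk (genOp P d) :=
  euler_conj (normOp_mul_normInv P d) (normInv_mul_normOp P d) (euler_normOp P d) _

theorem derivation_mul_mulLeft_sub (D : VF) (g : Ser) :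
    ((D : Ser →ₗ[ℂ] Ser) * LinearMap.mulLeft ℂ g - LinearMap.mulLeft ℂ g * (D : Ser →ₗ[ℂ] Ser) :
      Module.End ℂ Ser) = LinearMap.mulLeft ℂ (D g) := by
  ext1 f
  change D (g * f) - g * D f = D g * f
  rw [Derivation.leibniz, smul_eq_mul, smul_eq_mul]
  ring

/-- Each coefficient is, up to a scalar, a sum of commutators of generator derivations with lower
coefficients. The commutator of a derivation with multiplication by `g` is multiplication by the
derivative of `g`. -/
theorem conjMul_eq (f : Ser) (l : ℕ) :
    ∃ g : Ser, PowerSeries.coeff l (conjMul P d f) = LinearMap.mulLeft ℂ g := by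
  induction l using Nat.strong_induction_on with
  | _ l ih =>
    rcases Nat.eq_zero_or_pos l with rfl | hl
    · have h := congrArg (PowerSeries.coeff 0) (normOp_mul_normInv P d)
      refine ⟨f, ?_⟩
      rw [PowerSeries.coeff_mul] at h
      simp only [HasAntidiagonal.antidiagonal_zero, sum_singleton, normOp_zero, one_mul,
        PowerSeries.coeff_one, if_true] at h
      simp only [conjMul, PowerSeries.coeff_mul, HasAntidiagonal.antidiagonal_zero, sum_singleton,
        normOp_zero, h, one_mul, mul_one, PowerSeries.coeff_C, if_true]
    · have h := congrArg (PowerSeries.coeff l) (euler_conjMul P d f)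
      rw [coeff_euler, ← Nat.cast_smul_eq_nsmul ℂ] at h
      rw [eq_inv_smul_of_smul_eq hl h, map_sub, PowerSeries.coeff_mul, PowerSeries.coeff_mul,
        ← Nat.sum_antidiagonal_swap (n := l) (f := fun p => PowerSeries.coeff p.1
          (conjMul P d f) * PowerSeries.coeff p.2 (PowerSeries.mk (genOp P d))), ← sum_sub_distrib]
      have h2 : ∀ p ∈ antidiagonal l, ∃ g : Ser, PowerSeries.coeff p.1 (PowerSeries.mk (genOp P d))
          * PowerSeries.coeff p.2 (conjMul P d f) - PowerSeries.coeff p.swap.1 (conjMul P d f) *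
          PowerSeries.coeff p.swap.2 (PowerSeries.mk (genOp P d)) = LinearMap.mulLeft ℂ g := by
        intro p hp
        have hp' := HasAntidiagonal.mem_antidiagonal.1 hp
        rw [Prod.fst_swap, Prod.snd_swap, PowerSeries.coeff_mk]
        rcases Nat.eq_zero_or_pos p.1 with h0 | h0
        · exact ⟨0, by rw [h0, genOp_zero]; simp⟩
        · obtain ⟨g, hg⟩ := ih p.2 (by omega)
          obtain ⟨D, hD, -⟩ := exists_genOp_eq P d p.1
          exact ⟨D g, by rw [hg, hD, derivation_mul_mulLeft_sub]⟩
      choose! g hg using h2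
      refine ⟨(l : ℂ)⁻¹ • ∑ p ∈ antidiagonal l, g p, ?_⟩
      rw [sum_congr rfl hg]
      ext1 x
      simp [LinearMap.sum_apply, sum_mul]

/-- The operator `Θ f Θ⁻¹` is multiplication by some `h`, so `Θ(fg) = h Θ(g)`. Taking `g = 1`, where
`Θ(1) = 1`, identifies `h` as `Θ(f)`. -/
theorem coeff_normOp_mul (f g : Ser) (l : ℕ) : PowerSeries.coeff l (normOp P d) (f * g) =
    ∑ p ∈ antidiagonal l, PowerSeries.coeff p.1 (normOp P d) f *
      PowerSeries.coeff p.2 (normOp P d) g := by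
  have h1 : normOp P d * PowerSeries.C (LinearMap.mulLeft ℂ f) = conjMul P d f * normOp P d := by
    rw [conjMul, mul_assoc _ (normInv P d), normInv_mul_normOp, mul_one]
  choose h hh using conjMul_eq P d f
  have h2 : ∀ (k : ℕ) (g : Ser), PowerSeries.coeff k (normOp P d) (f * g) =
      ∑ p ∈ antidiagonal k, h p.1 * PowerSeries.coeff p.2 (normOp P d) g := by
    intro k g
    have := LinearMap.congr_fun (congrArg (PowerSeries.coeff k) h1) g
    rw [PowerSeries.coeff_mul_C, PowerSeries.coeff_mul, LinearMap.sum_apply] at this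
    simpa [hh] using this
  have h3 : ∀ k, PowerSeries.coeff k (normOp P d) f = h k := by
    intro k
    have := h2 k 1
    rw [mul_one] at this
    rw [this, sum_eq_single (k, 0)]
    · simp [normOp_zero]
    · rintro ⟨a, b⟩ hp hne
      have hp' := HasAntidiagonal.mem_antidiagonal.1 hp
      rw [normOp_apply_one, mul_zero]
      rcases Nat.eq_zero_or_pos b with h0 | h0
      · exact absurd (Prod.ext (by simp at hp' ⊢; omega) h0) hne
      · exact h0
    · intro h; simp at h
  rw [h2]
  exact sum_congr rfl fun p _ => by rw [h3]

/-- The normalizing change of coordinates. -/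
def normalization : Ser →ₐ[ℂ] Ser :=
  AlgHom.ofLinearMap (evalOp (normOp P d))
    (by
      rw [evalOp_apply]
      ext m
      rw [coeff_sumSer, sum_range_succ', sum_eq_zero]
      · simp [normOp_zero]
      · intro l _
        rw [normOp_apply_one P d _ l.succ_pos, map_zero])
    (fun f g => by
      have := isGraded_normOp P d
      rw [evalOp_apply, evalOp_apply, evalOp_apply, sumSer_mul (this.apply_mem f)
        (this.apply_mem g)]
      simp only [coeff_normOp_mul])

theorem evalOp_one : evalOp 1 = 1 := by
  have := evalOp_monomial one_mem_raising
  rwa [PowerSeries.monomial_zero_eq_C_apply, map_one] at this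

theorem normalization_bijective : Function.Bijective (normalization P d) := by
  have h1 := evalOp_mul (isGraded_normOp P d) (isGraded_normInv P d)
  have h2 := evalOp_mul (isGraded_normInv P d) (isGraded_normOp P d)
  rw [normOp_mul_normInv, evalOp_one] at h1
  rw [normInv_mul_normOp, evalOp_one] at h2
  refine Function.bijective_iff_has_inverse.2 ⟨evalOp (normInv P d), fun f => ?_, fun f => ?_⟩
  · exact (LinearMap.congr_fun h2 f).symm
  · exact (LinearMap.congr_fun h1 f).symm

/-- The normalizing change of coordinates as an automorphism. -/
def normEquiv : Ser ≃ₐ[ℂ] Ser := AlgEquiv.ofBijective _ (normalization_bijective P d)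

/-! ### The correction -/

/-- The correction of the field. -/
def correction : VF :=
  Derivation.mk' (evalOp (corrOp P d)) fun f g => by
    have hG := isGraded_corrOp P d
    rw [smul_eq_mul, smul_eq_mul, evalOp_apply]
    have hl : ∀ l, PowerSeries.coeff l (corrOp P d) (f * g) =
        f * PowerSeries.coeff l (corrOp P d) g + g * PowerSeries.coeff l (corrOp P d) f := by
      intro l
      obtain ⟨D, hD, -⟩ := exists_corrOp_eq P d l
      rw [hD]
      exact D.leibniz f g
    refine (eq_sumSer (fun l => hG.apply_mem _ l) fun N => ?_).symm
    have h1 := mul_mem_ordGE_right f (sumSer_sub_mem (hG.apply_mem g) N)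
    have h2 := mul_mem_ordGE_right g (sumSer_sub_mem (hG.apply_mem f) N)
    have := add_mem h1 h2
    rw [← evalOp_apply, ← evalOp_apply] at this
    convert this using 1
    simp only [hl, sum_add_distrib, ← mul_sum]
    ring

theorem coe_correction : (correction P d : Ser →ₗ[ℂ] Ser) = evalOp (corrOp P d) := rfl

theorem correction_apply (f : Ser) : correction P d f =
    sumSer fun l => PowerSeries.coeff l (corrOp P d) f := rfl

theorem linCenter_mem_raising : (linCenter : Ser →ₗ[ℂ] Ser) ∈ raising 0 := by
  rw [linCenter_eq]; exact homVF_mem_raising (by simp)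

theorem isGraded_C {T : Module.End ℂ Ser} (hT : T ∈ raising 0) : IsGraded (PowerSeries.C T) := by
  intro l
  rw [PowerSeries.coeff_C]
  split_ifs with h
  · rwa [h]
  · exact zero_mem _

theorem evalOp_C {T : Module.End ℂ Ser} (hT : T ∈ raising 0) : evalOp (PowerSeries.C T) = T := by
  rw [← PowerSeries.monomial_zero_eq_C_apply, evalOp_monomial hT]

theorem correction_commutes : ⁅linCenter, correction P d⁆ = 0 := by
  have hL := linCenter_mem_raising
  have hZ := isGraded_corrOp P d
  have h : PowerSeries.C (linCenter : Ser →ₗ[ℂ] Ser) * corrOp P d -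
      corrOp P d * PowerSeries.C (linCenter : Ser →ₗ[ℂ] Ser) =
      (0 : PowerSeries (Module.End ℂ Ser)) := by
    ext1 l
    rw [map_sub, PowerSeries.coeff_C_mul, PowerSeries.coeff_mul_C, coeff_corrOp,
      linCenter_mul_rep_sub, weightCalc_id_resPart, map_zero, map_zero]
  have h' := congrArg evalOp h
  rw [evalOp_sub, evalOp_mul (isGraded_C hL) hZ, evalOp_mul hZ (isGraded_C hL), evalOp_C hL,
    ← coe_correction, ← coe_lie] at h'
  ext1 f
  have := LinearMap.congr_fun h' f
  refine this.trans ?_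
  rw [evalOp_apply]
  ext m
  simp [coeff_sumSer]

theorem correction_order (f : Ser) (hf : f ∈ ordGE 1) : correction P d f ∈ ordGE 2 := by
  rw [correction_apply]
  refine sumSer_mem fun l => ?_
  rcases l with _ | l
  · rw [coeff_corrOp, resPart_zero, map_zero]; exact zero_mem _
  · exact ordGE_mono (by omega) (isGraded_corrOp P d (l + 1) 1 f hf)

/-- The sum of the operators of the letters. -/
def letterField : VF := ∑ n ∈ alphabet d, opB P n

theorem coe_letterField : (letterField P d : Ser →ₗ[ℂ] Ser) =
    rep P (∑ n ∈ alphabet d, wd [n]) := by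
  rw [map_sum, letterField, coe_sum]
  simp only [rep_letter]

theorem letterField_mem_raising : (letterField P d : Ser →ₗ[ℂ] Ser) ∈ raising 1 := by
  rw [coe_letterField, map_sum]
  refine sum_mem fun n hn => ?_
  have := nested_mem_raising P (w := [n]) (d := d) (by simpa using hn)
  rwa [← rep_nest] at this

/-- The free-algebra identity is transported to graded series of operators, where the weight
derivation becomes the commutator with `linCenter`, and is then summed over lengths. -/
theorem normalization_conjugates (f : Ser) :
    (linCenter + letterField P d - correction P d) (normEquiv P d f) =
      normEquiv P d (linCenter f) := by
  have hL := linCenter_mem_raising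
  have hB := letterField_mem_raising P d
  have hZ := isGraded_corrOp P d
  have hT := isGraded_normOp P d
  have e1 : PowerSeries.map (rep P) (letterSer (alphabet d)) =
      PowerSeries.monomial 1 (letterField P d : Ser →ₗ[ℂ] Ser) := by
    ext1 l
    rw [PowerSeries.coeff_map, letterSer, PowerSeries.coeff_mk, PowerSeries.coeff_monomial,
      letterSum]
    split_ifs
    · rw [coe_letterField]
    · rw [map_zero]
  have hB' : IsGraded (PowerSeries.monomial 1 (letterField P d : Ser →ₗ[ℂ] Ser)) := by
    intro l
    rw [PowerSeries.coeff_monomial]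
    split_ifs with h
    · rwa [h]
    · exact zero_mem _
  have e2 : PowerSeries.map (rep P)
      (mapCoeff (weightCalc weight id).toAddMonoidHom (normSer (alphabet d) weight)) =
      PowerSeries.C (linCenter : Ser →ₗ[ℂ] Ser) * normOp P d -
        normOp P d * PowerSeries.C (linCenter : Ser →ₗ[ℂ] Ser) := by
    ext1 l
    rw [map_sub, PowerSeries.coeff_C_mul, PowerSeries.coeff_mul_C, PowerSeries.coeff_map,
      coeff_mapCoeff, normOp, PowerSeries.coeff_map, linCenter_mul_rep_sub]
    rfl
  have h := congrArg (PowerSeries.map (rep P)) (normSer_equation (alphabet d) weight)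
  rw [map_sub, map_add, map_mul, map_mul, e1, e2, map_zero] at h
  have h' : PowerSeries.C (linCenter : Ser →ₗ[ℂ] Ser) * normOp P d +
      PowerSeries.monomial 1 (letterField P d : Ser →ₗ[ℂ] Ser) * normOp P d -
      corrOp P d * normOp P d = normOp P d * PowerSeries.C (linCenter : Ser →ₗ[ℂ] Ser) := by
    rw [← sub_eq_zero, ← h]
    simp only [normOp, corrOp]
    abel
  have h'' := congrArg evalOp h'
  rw [evalOp_sub, evalOp_add, evalOp_mul (isGraded_C hL) hT, evalOp_mul hB' hT, evalOp_mul hZ hT,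
    evalOp_mul hT (isGraded_C hL), evalOp_C hL, evalOp_monomial hB] at h''
  exact LinearMap.congr_fun h'' f

end Representation

/-! ### Existence of the correction -/

section Existence

variable {P : MvPolynomial (Fin 2) ℂ} {d : ℕ}

theorem IsPerturbation.coeff_eq_zero (hP : IsPerturbation d P) {m : Fin 2 →₀ ℕ}
    (hm : ¬(2 ≤ m.degree ∧ m.degree ≤ d)) : P.coeff m = 0 := by
  by_contra h
  exact hm (hP m (MvPolynomial.mem_support_iff.2 h))

theorem mem_alphabet {n : ℤ × ℤ} : n ∈ alphabet d ↔
    -1 ≤ n.1 ∧ -1 ≤ n.2 ∧ 1 ≤ n.1 + n.2 ∧ n.1 + n.2 ≤ (d : ℤ) - 1 := by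
  simp only [alphabet, mem_filter, mem_product, mem_Icc]
  omega

theorem expo_self (m : Fin 2 →₀ ℕ) : expo (m 0) (m 1) = m := ((expo_eq_iff _ _ m).2 ⟨rfl, rfl⟩).symm

theorem coeff_eq_pc (P : MvPolynomial (Fin 2) ℂ) (m : Fin 2 →₀ ℕ) :
    P.coeff m = pc P ((m 0 : ℤ) - 1, (m 1 : ℤ)) := by
  rw [pc, if_pos (by simp; omega)]
  simp [expo_self]

theorem coeff_eq_qc (Q : MvPolynomial (Fin 2) ℂ) (m : Fin 2 →₀ ℕ) :
    Q.coeff m = qc Q ((m 0 : ℤ), (m 1 : ℤ) - 1) := by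
  rw [qc, if_pos (by simp; omega)]
  simp [expo_self]

theorem IsPerturbation.pc_eq_zero (hP : IsPerturbation d P) {n : ℤ × ℤ} (hn : n ∉ alphabet d) :
    pc P n = 0 := by
  unfold pc
  split_ifs with h
  · refine hP.coeff_eq_zero fun hm => hn ?_
    rw [degree_eq, expo_apply_zero, expo_apply_one] at hm
    rw [mem_alphabet]
    omega
  · rfl

theorem IsPerturbation.qc_eq_zero (hP : IsPerturbation d P) {n : ℤ × ℤ} (hn : n ∉ alphabet d) :
    qc (conjSwap P) n = 0 := by
  rw [qc_conjSwap, hP.pc_eq_zero, map_zero]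
  rw [mem_alphabet] at hn ⊢
  simp only [Prod.fst_swap, Prod.snd_swap]
  omega

theorem realField_eq (hP : IsPerturbation d P) : realField P = linCenter + letterField P d := by
  rw [realField, letterField]
  congr 1
  have happ : ∀ f, (∑ n ∈ alphabet d, opB P n) f = ∑ n ∈ alphabet d, opB P n f := by
    intro f
    have := LinearMap.congr_fun (coe_sum (alphabet d) (opB P)) f
    simpa using this
  apply derivation_ext
  · rw [vf_sx, happ]
    ext m
    simp only [opB_eq, homVF, vf_sx, map_sum, coeff_zmon]
    rw [MvPolynomial.coeff_coe, coeff_eq_pc]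
    by_cases h : ((m 0 : ℤ) - 1, (m 1 : ℤ)) ∈ alphabet d
    · rw [sum_eq_single _ _ fun h' => absurd h h', if_pos (by simp)]
      rintro ⟨a, b⟩ - hne
      rw [if_neg]
      rintro ⟨h1, h2⟩
      exact hne (Prod.ext (by simp at h1 ⊢; omega) h2.symm)
    · rw [hP.pc_eq_zero h, sum_eq_zero]
      intro n hn
      rw [if_neg]
      rintro ⟨h1, h2⟩
      apply h
      rwa [h1, h2, add_sub_cancel_right]
  · rw [vf_sy, happ]
    ext m
    simp only [opB_eq, homVF, vf_sy, map_sum, coeff_zmon]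
    rw [MvPolynomial.coeff_coe, coeff_eq_qc]
    by_cases h : ((m 0 : ℤ), (m 1 : ℤ) - 1) ∈ alphabet d
    · rw [sum_eq_single _ _ fun h' => absurd h h', if_pos (by simp)]
      rintro ⟨a, b⟩ - hne
      rw [if_neg]
      rintro ⟨h1, h2⟩
      exact hne (Prod.ext h1.symm (by simp at h2 ⊢; omega))
    · rw [hP.qc_eq_zero h, sum_eq_zero]
      intro n hn
      rw [if_neg]
      rintro ⟨h1, h2⟩
      apply h
      rwa [h1, h2, add_sub_cancel_right]

theorem isCorrection_correction (hP : IsPerturbation d P) :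
    IsCorrection (realField P) (correction P d) where
  order_x := mem_ordGE_iff_order.1 (correction_order P d sx (X_mem_ordGE 0))
  order_y := mem_ordGE_iff_order.1 (correction_order P d sy (X_mem_ordGE 1))
  commutes := correction_commutes P d
  conjugate := ⟨normEquiv P d, fun f => by
    rw [realField_eq hP]
    exact normalization_conjugates P d f⟩

end Existence

/-! ### Uniqueness of the correction -/

section Uniqueness

/-- The eigenvalues of the linear center on the coordinates. -/
def eigenvalue (i : Fin 2) : ℂ := if i = 0 then Complex.I else -Complex.I

theorem coeff_X_mul_pderiv (i : Fin 2) (f : Ser) (m : Fin 2 →₀ ℕ) :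
    MvPowerSeries.coeff m (MvPowerSeries.X i * MvPowerSeries.pderiv ℂ i f) =
      m i * MvPowerSeries.coeff m f := by
  rw [coeff_X_mul]
  split_ifs with h
  · rw [MvPowerSeries.coeff_pderiv, tsub_add_cancel_of_le (by simpa using h)]
    simp only [Finsupp.tsub_apply, Finsupp.single_eq_same]
    rw [Nat.cast_sub h]
    push_cast
    ring
  · have : m i = 0 := by omega
    simp [this]

theorem coeff_linCenter (f : Ser) (m : Fin 2 →₀ ℕ) : MvPowerSeries.coeff m (linCenter f) =
    Complex.I * ((m 0 : ℂ) - m 1) * MvPowerSeries.coeff m f := by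
  rw [linCenter, vf_apply, mul_assoc, neg_mul, mul_assoc, map_add, map_neg,
    MvPowerSeries.coeff_C_mul, MvPowerSeries.coeff_C_mul, coeff_X_mul_pderiv, coeff_X_mul_pderiv]
  ring

theorem linCenter_X (i : Fin 2) :
    linCenter (MvPowerSeries.X i) = eigenvalue i • (MvPowerSeries.X i : Ser) := by
  rw [linCenter]
  fin_cases i
  · simp [eigenvalue, MvPowerSeries.smul_eq_C_mul]
  · simp [eigenvalue, MvPowerSeries.smul_eq_C_mul]

theorem weight_ne_eigenvalue {i j : Fin 2} (h : j ≠ i) :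
    Complex.I * (((Finsupp.single j 1 : Fin 2 →₀ ℕ) 0 : ℂ) -
      ((Finsupp.single j 1 : Fin 2 →₀ ℕ) 1 : ℕ)) ≠ eigenvalue i := by
  have hI : Complex.I ≠ -Complex.I := fun h => Complex.I_ne_zero (self_eq_neg.1 h)
  fin_cases i <;> fin_cases j <;> simp [eigenvalue] at h ⊢
  · exact hI.symm
  · exact hI

theorem eq_single_of_degree_eq_one {m : Fin 2 →₀ ℕ} (h : m.degree = 1) :
    ∃ j, m = Finsupp.single j 1 := by
  rw [degree_eq] at h
  rcases Nat.eq_zero_or_pos (m 0) with h0 | h0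
  · refine ⟨1, ?_⟩
    ext i; fin_cases i
    · simpa using h0
    · simp; omega
  · refine ⟨0, ?_⟩
    ext i; fin_cases i
    · simp; omega
    · simp; omega

theorem degree_eq_zero_iff' {m : Fin 2 →₀ ℕ} : m.degree = 0 ↔ m = 0 := Finsupp.degree_eq_zero_iff m

/-- An eigenvector of a field with linear part `linCenter` for the eigenvalue of a coordinate is
a multiple of that coordinate up to higher order. -/
theorem eigenvector_linear_part {N : VF} (hN : (N : Ser →ₗ[ℂ] Ser) ∈ raising 1) {i : Fin 2}
    {h : Ser} (hh : (linCenter + N) h = eigenvalue i • h) :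
    h - MvPowerSeries.coeff (Finsupp.single i 1) h • (MvPowerSeries.X i : Ser) ∈ ordGE 2 := by
  classical
  have hε : eigenvalue i ≠ 0 := by
    unfold eigenvalue; split_ifs <;> simp [Complex.I_ne_zero]
  have hc : ∀ m, Complex.I * ((m 0 : ℂ) - m 1) * MvPowerSeries.coeff m h +
      MvPowerSeries.coeff m (N h) = eigenvalue i * MvPowerSeries.coeff m h := by
    intro m
    have := congrArg (MvPowerSeries.coeff m) hh
    rwa [Derivation.add_apply, map_add, coeff_linCenter, map_smul, smul_eq_mul] at this
  -- The constant monomial has weight zero, which differs from the eigenvalue.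
  have h0 : MvPowerSeries.coeff 0 h = 0 := by
    have h1 : MvPowerSeries.coeff 0 (N h) = 0 := hN 0 h (mem_ordGE_zero h) 0 (by simp)
    have h2 := hc 0
    rw [h1] at h2
    simpa [hε] using h2
  have hmem : h ∈ ordGE 1 := by
    intro m hm
    obtain rfl := degree_eq_zero_iff'.1 (Nat.lt_one_iff.1 hm)
    exact h0
  intro m hm
  rw [map_sub, map_smul, MvPowerSeries.coeff_X]
  rcases Nat.lt_or_ge m.degree 1 with h1 | h1
  · obtain rfl := degree_eq_zero_iff'.1 (Nat.lt_one_iff.1 h1)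
    rw [h0, if_neg (by intro h; simpa using congrArg (fun m => m i) h), smul_zero, sub_zero]
  · obtain ⟨j, rfl⟩ := eq_single_of_degree_eq_one (by omega : m.degree = 1)
    by_cases hj : j = i
    · subst hj; simp
    -- The other linear monomial has the opposite eigenvalue of the linear centre, and `N`
    -- contributes only in order two and above.
    · have h2 := hc (Finsupp.single j 1)
      have hNh : MvPowerSeries.coeff (Finsupp.single j 1) (N h) = 0 := hN 1 h hmem _ hm
      rw [hNh, add_zero] at h2
      have h3 : MvPowerSeries.coeff (Finsupp.single j 1) h = 0 := by
        by_contra hne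
        exact weight_ne_eigenvalue hj (mul_right_cancel₀ hne h2)
      rw [h3, if_neg (by rw [Finsupp.single_left_inj one_ne_zero]; exact hj), smul_zero, sub_zero]

theorem coeff_mul_of_sub_mem {i j : Fin 2} {h b : Ser} {c : ℂ}
    (hh : h - c • (MvPowerSeries.X j : Ser) ∈ ordGE 2) (hc : j = i → c = 0) :
    MvPowerSeries.coeff (Finsupp.single i 1) (h * b) = 0 := by
  have h1 : (h - c • (MvPowerSeries.X j : Ser)) * b ∈ ordGE 2 := by
    rw [mul_comm]; exact mul_mem_ordGE_right b hh
  have h2 := h1 (Finsupp.single i 1) (by simp)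
  rw [sub_mul, map_sub, sub_eq_zero] at h2
  rw [h2, smul_mul_assoc, map_smul, coeff_X_mul]
  by_cases hj : j = i
  · rw [hc hj, zero_smul]
  · rw [if_neg (by rw [Finsupp.single_eq_of_ne hj]; simp), smul_zero]

/-- If `Θ` of a coordinate had no multiple of that coordinate in its linear part, neither `Θ sx` nor
`Θ sy` would contain it linearly. The coordinate could then not be in the image of `Θ`. -/
theorem linear_coeff_ne_zero (Θ : Ser ≃ₐ[ℂ] Ser)
    (h : ∀ j, Θ (MvPowerSeries.X j) - MvPowerSeries.coeff (Finsupp.single j 1)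
      (Θ (MvPowerSeries.X j)) • (MvPowerSeries.X j : Ser) ∈ ordGE 2) (i : Fin 2) :
    MvPowerSeries.coeff (Finsupp.single i 1) (Θ (MvPowerSeries.X i)) ≠ 0 := by
  intro hi
  set f := Θ.symm (MvPowerSeries.X i) with hf
  have h1 : (MvPowerSeries.X i : Ser) = cst (MvPowerSeries.coeff 0 f) +
      (Θ sx * Θ (quotX f) + Θ sy * Θ (quotY f)) := by
    have h2 : Θ f = MvPowerSeries.X i := Θ.apply_symm_apply _
    have h3 : Θ (cst (MvPowerSeries.coeff 0 f)) = cst (MvPowerSeries.coeff 0 f) :=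
      Θ.commutes (MvPowerSeries.coeff 0 f)
    rw [← h3, ← map_mul, ← map_mul, ← map_add, ← map_add, ← eq_cst_add_mul f, h2]
  have h4 := congrArg (MvPowerSeries.coeff (Finsupp.single i 1)) h1
  classical
  rw [map_add, map_add, coeff_mul_of_sub_mem (h 0) (by rintro rfl; exact hi),
    coeff_mul_of_sub_mem (h 1) (by rintro rfl; exact hi), MvPowerSeries.coeff_X, if_pos rfl,
    MvPowerSeries.coeff_C, if_neg (by simp)] at h4
  simp at h4

theorem evalOp_sub_self_mem {T : PowerSeries (Module.End ℂ Ser)} (hT : IsGraded T)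
    (h0 : PowerSeries.coeff 0 T = 1) {k : ℕ} {f : Ser} (hf : f ∈ ordGE k) :
    evalOp T f - f ∈ ordGE (k + 1) := by
  have h1 : evalOp (T - 1) ∈ raising 1 := by
    refine evalOp_mem_raising fun l => ?_
    rcases l with _ | l
    · rw [map_sub, h0, PowerSeries.coeff_one, if_pos rfl, sub_self]; exact zero_mem _
    · rw [map_sub, PowerSeries.coeff_one, if_neg l.succ_ne_zero, sub_zero]
      exact raising_mono (by omega) (hT (l + 1))
  have h2 := h1 k f hf
  rwa [evalOp_sub, evalOp_one] at h2

variable {P : MvPolynomial (Fin 2) ℂ} {d : ℕ}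

theorem coeff_normInv_zero : PowerSeries.coeff 0 (normInv P d) = 1 := by
  rw [normInv, PowerSeries.coeff_zero_eq_constantCoeff_apply, PowerSeries.constantCoeff_invOfUnit]
  simp

theorem normEquiv_evalOp_normInv (f : Ser) : normEquiv P d (evalOp (normInv P d) f) = f := by
  have h1 := evalOp_mul (isGraded_normOp P d) (isGraded_normInv P d)
  rw [normOp_mul_normInv, evalOp_one] at h1
  exact (LinearMap.congr_fun h1 f).symm

theorem coeff_eq_zero_of_commutes {D : VF} (hD : ⁅linCenter, D⁆ = 0) {i : Fin 2}
    {m : Fin 2 →₀ ℕ} (hm : Complex.I * ((m 0 : ℂ) - m 1) ≠ eigenvalue i) :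
    MvPowerSeries.coeff m (D (MvPowerSeries.X i)) = 0 := by
  have h1 : ⁅linCenter, D⁆ (MvPowerSeries.X i) = 0 := by rw [hD]; rfl
  rw [Derivation.commutator_apply, linCenter_X, D.map_smul, sub_eq_zero] at h1
  have h2 := congrArg (MvPowerSeries.coeff m) h1
  rw [coeff_linCenter, map_smul, smul_eq_mul] at h2
  by_contra hne
  exact hm (mul_right_cancel₀ hne h2)

/-- Induction on the order of the difference `Δ`. Commuting with `linCenter` leaves only resonant
coefficients of `Δ`, and these are the obstruction to having eigenvectors with the same eigenvalue
for both normalizable fields. -/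
theorem IsCorrection.eq_correction (hP : IsPerturbation d P) {Z : VF}
    (hZ : IsCorrection (realField P) Z) : Z = correction P d := by
  have hC := isCorrection_correction hP
  obtain ⟨Θ, hΘ⟩ := hZ.conjugate
  -- the field without its linear part raises the order
  have hN : ((letterField P d - Z : VF) : Ser →ₗ[ℂ] Ser) ∈ raising 1 := by
    rw [Derivation.coe_sub_linearMap]
    refine sub_mem (letterField_mem_raising P d) (derivation_mem_raising ?_ ?_)
    · exact mem_ordGE_iff_order.2 hZ.order_x
    · exact mem_ordGE_iff_order.2 hZ.order_y
  have hU : realField P - Z = linCenter + (letterField P d - Z) := by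
    rw [realField_eq hP, add_sub_assoc]
  have heig : ∀ i : Fin 2, (realField P - Z) (Θ (MvPowerSeries.X i)) =
      eigenvalue i • Θ (MvPowerSeries.X i) := by
    intro i
    rw [hΘ, linCenter_X, map_smul]
  have hlin : ∀ i : Fin 2, Θ (MvPowerSeries.X i) - MvPowerSeries.coeff (Finsupp.single i 1)
      (Θ (MvPowerSeries.X i)) • (MvPowerSeries.X i : Ser) ∈ ordGE 2 := by
    intro i
    refine eigenvector_linear_part hN ?_
    rw [← hU, heig]
  have hne := linear_coeff_ne_zero Θ hlin
  set Δ : VF := Z - correction P d with hΔ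
  have hcomm : ⁅linCenter, Δ⁆ = 0 := by
    ext1 f
    have h1 := congrArg (fun D : VF => D f) hZ.commutes
    have h2 := congrArg (fun D : VF => D f) hC.commutes
    simp only [Derivation.commutator_apply, Derivation.coe_zero, Pi.zero_apply] at h1 h2
    simp only [hΔ, Derivation.commutator_apply, Derivation.sub_apply, map_sub,
      Derivation.coe_zero, Pi.zero_apply]
    linear_combination h1 - h2
  have key : ∀ k, (∀ i : Fin 2, Δ (MvPowerSeries.X i) ∈ ordGE (k + 2)) := by
    intro k
    induction k with
    | zero =>
      have h1 : Δ sx ∈ ordGE 2 := sub_mem (mem_ordGE_iff_order.2 hZ.order_x)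
        (mem_ordGE_iff_order.2 hC.order_x)
      have h2 : Δ sy ∈ ordGE 2 := sub_mem (mem_ordGE_iff_order.2 hZ.order_y)
        (mem_ordGE_iff_order.2 hC.order_y)
      intro i
      fin_cases i
      exacts [h1, h2]
    | succ k ih =>
      have hr : (Δ : Ser →ₗ[ℂ] Ser) ∈ raising (k + 1) := by
        refine derivation_mem_raising ?_ ?_
        · rw [show 1 + (k + 1) = k + 2 by ring]; exact ih 0
        · rw [show 1 + (k + 1) = k + 2 by ring]; exact ih 1
      intro i m hm
      by_cases hres : Complex.I * ((m 0 : ℂ) - m 1) = eigenvalue i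
      swap
      · exact coeff_eq_zero_of_commutes hcomm hres
      set h := Θ (MvPowerSeries.X i) with hh
      set c := MvPowerSeries.coeff (Finsupp.single i 1) h with hc
      set g := evalOp (normInv P d) h with hg
      have hgh : normEquiv P d g = h := normEquiv_evalOp_normInv h
      -- The eigenvector `h` of the field minus `Z`, pulled back by the constructed normalization,
      -- is an eigenvector of the linear centre up to the pullback of `Δ h`.
      have e1 : linCenter g = eigenvalue i • g + evalOp (normInv P d) (Δ h) := by
        apply (normEquiv P d).injective
        rw [map_add, map_smul, hgh, normEquiv_evalOp_normInv,
          ← normalization_conjugates P d g, hgh, ← heig i, ← realField_eq hP, hΔ]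
        simp only [Derivation.sub_apply]
        abel
      -- At a monomial whose weight is the eigenvalue, the first two terms of the previous identity
      -- cancel.
      have e2 : MvPowerSeries.coeff m (evalOp (normInv P d) (Δ h)) = 0 := by
        have := congrArg (MvPowerSeries.coeff m) e1
        rw [coeff_linCenter, hres, map_add, map_smul, smul_eq_mul] at this
        exact left_eq_add.1 this
      -- To leading order `Δ h` is `c` times `Δ` of the coordinate, and the inverse normalization is
      -- the identity. Since `c ≠ 0`, the resonant coefficient vanishes.
      have h1 : Δ (h - c • (MvPowerSeries.X i : Ser)) ∈ ordGE (2 + (k + 1)) := hr 2 _ (hlin i)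
      have h2 : Δ h ∈ ordGE (k + 2) := by
        have := add_mem (ordGE_mono (by omega : k + 2 ≤ 2 + (k + 1)) h1)
          (Submodule.smul_mem _ c (ih i))
        rwa [map_sub, Δ.map_smul, sub_add_cancel] at this
      have h3 := evalOp_sub_self_mem (isGraded_normInv P d) coeff_normInv_zero h2 m hm
      have h4 := h1 m (by omega)
      rw [map_sub, e2, zero_sub, neg_eq_zero] at h3
      rw [map_sub, map_sub, h3, Δ.map_smul, map_smul, smul_eq_mul, zero_sub, neg_eq_zero,
        mul_eq_zero] at h4
      exact h4.resolve_left (hne i)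
  have hz : ∀ i : Fin 2, Δ (MvPowerSeries.X i) = 0 := by
    intro i
    refine eq_of_forall_sub_mem_ordGE fun N => ?_
    rw [sub_zero]
    exact ordGE_mono (by omega) (key N i)
  exact sub_eq_zero.1 (derivation_eq_zero (hz 0) (hz 1))

end Uniqueness

/-! ### The parts of given depth -/

section Depth

variable {P : MvPolynomial (Fin 2) ℂ} {d : ℕ}

theorem mould_eq (w : List (ℤ × ℤ)) : mould w = mouldOf weight w := rfl

theorem mem_words {q l : ℕ} {w : List (ℤ × ℤ)} : w ∈ words d q l ↔
    (w.length = l ∧ ∀ n ∈ w, n ∈ alphabet d) ∧ size₁ w + size₂ w = q := by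
  change w ∈ (wordsOver (alphabet d) l).filter _ ↔ _
  rw [mem_filter, mem_wordsOver]

theorem wt_depth (w : List (ℤ × ℤ)) :
    wt (fun n : ℤ × ℤ => n.1 + n.2) w = size₁ w + size₂ w := by
  induction w with
  | nil => simp [size₁, size₂]
  | cons n w ih => rw [wt_cons, ih, size₁_cons, size₂_cons]; ring

theorem words_eq_filter (q l : ℕ) : words d q l =
    {w ∈ wordsOver (alphabet d) l | wt (fun n : ℤ × ℤ => n.1 + n.2) w = (q : ℤ)} := by
  ext w
  rw [mem_words, mem_filter, mem_wordsOver, wt_depth]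

theorem rep_dynkin (P : MvPolynomial (Fin 2) ℂ) (q l : ℕ) :
    ∑ w ∈ words d q l, mould w • (nested P w : Ser →ₗ[ℂ] Ser) =
      (l : ℂ) • ∑ w ∈ words d q l, mould w • opWord P w := by
  have h := congrArg (rep P) (dynkin_mouldSum (alphabet d) weight
    (fun n : ℤ × ℤ => n.1 + n.2) (q : ℤ) l)
  rw [rep_smul, map_sum, map_sum, ← words_eq_filter] at h
  simpa only [rep_smul, rep_nest, rep_wd, ← mould_eq] using h

/-- Dynkin's identity expresses each length as a combination of vector fields; single compositions
are not homogeneous fields whose coefficients could be read off. -/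
theorem rep_resPart_apply (P : MvPolynomial (Fin 2) ℂ) {l : ℕ} (hl : 0 < l) (f : Ser) :
    rep P (resPart (alphabet d) weight l) f =
      (l : ℂ)⁻¹ • ∑ w ∈ wordsOver (alphabet d) l, mould w • nested P w f := by
  have h := congrArg (rep P) (dynkin_of_mem_lieSpan (resPart_mem_lieSpan (alphabet d) weight l))
  rw [rep_smul] at h
  rw [eq_inv_smul_of_smul_eq (M := Module.End ℂ Ser) hl h.symm, LinearMap.smul_apply,
    resPart_eq_mouldSum]
  congr 1
  simp only [mouldSum, dynkin, map_sum, map_smul, onWords_wd, LinearMap.sum_apply, rep_smul,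
    rep_nest, ← mould_eq]
  rfl

theorem sum_apply {κ : Type*} (s : Finset κ) (D : κ → VF) (f : Ser) :
    (∑ i ∈ s, D i) f = ∑ i ∈ s, D i f := by
  have := LinearMap.congr_fun (coe_sum s D) f
  simpa using this

/-- The Lie form of the part of depth `q` of the correction. -/
def corrPart (P : MvPolynomial (Fin 2) ℂ) (d q : ℕ) : VF :=
  ∑ l ∈ Icc 1 q, (l : ℂ)⁻¹ • ∑ w ∈ words d q l, mould w • nested P w

theorem corrPart_apply (q : ℕ) (f : Ser) : corrPart P d q f =
    ∑ l ∈ Icc 1 q, (l : ℂ)⁻¹ • ∑ w ∈ words d q l, mould w • nested P w f := by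
  rw [corrPart, sum_apply]
  refine sum_congr rfl fun l _ => ?_
  rw [Derivation.smul_apply, sum_apply]
  rfl

/-- A nested bracket of depth `q` takes a coordinate to a series homogeneous of degree `q + 1`.
Selecting that degree therefore selects the words of depth `q`. -/
theorem homogeneousComponent_correction {q : ℕ} {f : Ser}
    (hf : ∀ (w : List (ℤ × ℤ)) (m : Fin 2 →₀ ℕ), (m.degree : ℤ) ≠ size₁ w + size₂ w + 1 →
      MvPowerSeries.coeff m (nested P w f) = 0) :
    MvPowerSeries.homogeneousComponent (q + 1) (correction P d f) = corrPart P d q f := by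
  ext m
  rw [MvPowerSeries.coeff_homogeneousComponent, corrPart_apply, map_sum]
  split_ifs with hm
  · rw [correction_apply, coeff_sumSer, hm, sum_range_succ', coeff_corrOp, resPart_zero, map_zero,
      LinearMap.zero_apply, map_zero, add_zero]
    have h1 : ∀ l, MvPowerSeries.coeff m (PowerSeries.coeff (l + 1) (corrOp P d) f) =
        MvPowerSeries.coeff m (((l + 1 : ℕ) : ℂ)⁻¹ •
          ∑ w ∈ words d q (l + 1), mould w • nested P w f) := by
      intro l
      rw [coeff_corrOp, rep_resPart_apply P l.succ_pos, map_smul, map_smul, map_sum, map_sum,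
        words_eq_filter, sum_filter]
      congr 1
      refine sum_congr rfl fun w _ => ?_
      split_ifs with hw
      · rfl
      · rw [map_smul, hf w m, smul_zero]
        rw [wt_depth] at hw
        rw [hm]; push_cast; omega
    rw [sum_congr rfl fun l _ => h1 l, sum_range_succ]
    -- The coefficient formula sums lengths up to `q + 1`, but every letter has depth at least one.
    have h2 : words d q (q + 1) = ∅ := by
      rw [eq_empty_iff_forall_notMem]
      intro w hw
      obtain ⟨⟨h3, h4⟩, h5⟩ := mem_words.1 hw
      have := length_le_size h4
      omega
    rw [h2, sum_empty, smul_zero, map_zero, add_zero, range_eq_Ico,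
      sum_Ico_add' (fun l : ℕ => MvPowerSeries.coeff m ((l : ℂ)⁻¹ •
        ∑ w ∈ words d q l, mould w • nested P w f)) 0 q 1]
    rfl
  · symm
    refine sum_eq_zero fun l _ => ?_
    rw [map_smul, map_sum, sum_eq_zero, smul_zero]
    intro w hw
    rw [map_smul, hf w m, smul_zero]
    rw [(mem_words.1 hw).2]
    exact_mod_cast hm

theorem depthPart_correction (q : ℕ) : depthPart q (correction P d) = corrPart P d q := by
  apply derivation_ext
  · rw [depthPart, vf_sx]
    refine homogeneousComponent_correction fun w m hm => ?_
    rw [nested_eq_homVF, homVF, vf_sx, coeff_zmon, if_neg]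
    rw [degree_eq] at hm
    omega
  · rw [depthPart, vf_sy]
    refine homogeneousComponent_correction fun w m hm => ?_
    rw [nested_eq_homVF, homVF, vf_sy, coeff_zmon, if_neg]
    rw [degree_eq] at hm
    omega

theorem coe_corrPart (q : ℕ) : (corrPart P d q : Ser →ₗ[ℂ] Ser) = mouldTerm P d q := by
  rw [corrPart, coe_sum, mouldTerm]
  refine sum_congr rfl fun l hl => ?_
  have hl' : (l : ℂ) ≠ 0 := Nat.cast_ne_zero.2 (by have := mem_Icc.1 hl; omega)
  have h := rep_dynkin (d := d) P q l
  rw [Derivation.coe_smul_linearMap, coe_sum]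
  simp only [Derivation.coe_smul_linearMap]
  rw [h]
  exact inv_smul_smul₀ hl' _

theorem wt_weight (w : List (ℤ × ℤ)) :
    wt weight w = Complex.I * ((size₁ w - size₂ w : ℤ) : ℂ) := by
  induction w with
  | nil => simp [size₁, size₂]
  | cons n w ih =>
    rw [wt_cons, ih, size₁_cons, size₂_cons, weight]
    push_cast
    ring

theorem size_eq_of_resonant {p l : ℕ} {w : List (ℤ × ℤ)} (hw : w ∈ words d (2 * p) l)
    (h : wt weight w = 0) : size₁ w = p ∧ size₂ w = p := by
  rw [wt_weight, mul_eq_zero, or_iff_right Complex.I_ne_zero, Int.cast_eq_zero] at h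
  have := (mem_words.1 hw).2
  push_cast at this
  omega

theorem add_homVF (s t : ℤ) (a b a' b' : ℂ) :
    homVF s t a b + homVF s t a' b' = homVF s t (a + a') (b + b') := by
  apply derivation_ext <;> simp [homVF, zmon_add]

theorem sum_homVF {κ : Type*} (s t : ℤ) (S : Finset κ) (a b : κ → ℂ) :
    ∑ i ∈ S, homVF s t (a i) (b i) = homVF s t (∑ i ∈ S, a i) (∑ i ∈ S, b i) := by
  classical
  induction S using Finset.induction_on with
  | empty =>
    rw [sum_empty, sum_empty, sum_empty]
    apply derivation_ext <;> simp [homVF, zmon_zero]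
  | insert i S hi ih => rw [sum_insert hi, sum_insert hi, sum_insert hi, ih, add_homVF]

/-! ### The conjugation symmetry -/

theorem size_map_swap (w : List (ℤ × ℤ)) :
    size₁ (w.map Prod.swap) = size₂ w ∧ size₂ (w.map Prod.swap) = size₁ w := by
  simp [size₁, size₂, Function.comp_def]

theorem pc_swap (P : MvPolynomial (Fin 2) ℂ) (n : ℤ × ℤ) :
    pc P n.swap = starRingEnd ℂ (qc (conjSwap P) n) := by
  rw [qc_conjSwap, Complex.conj_conj]

theorem evalCoeff_genPQ_cons (P : MvPolynomial (Fin 2) ℂ) (n m : ℤ × ℤ) (t : List (ℤ × ℤ)) :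
    evalCoeff P (genPQ (n :: m :: t)).1 =
      (size₁ (m :: t) - n.1) * (pc P n * evalCoeff P (genPQ (m :: t)).1) +
      size₂ (m :: t) * (qc (conjSwap P) n * evalCoeff P (genPQ (m :: t)).1) -
      n.2 * (pc P n * evalCoeff P (genPQ (m :: t)).2) ∧
    evalCoeff P (genPQ (n :: m :: t)).2 =
      (size₂ (m :: t) - n.2) * (qc (conjSwap P) n * evalCoeff P (genPQ (m :: t)).2) +
      size₁ (m :: t) * (pc P n * evalCoeff P (genPQ (m :: t)).2) -
      n.1 * (qc (conjSwap P) n * evalCoeff P (genPQ (m :: t)).1) := by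
  constructor <;>
  simp only [genPQ, map_sub, map_add, map_mul, evalCoeff_varP, evalCoeff_varQ,
      zsmul_eq_mul, map_intCast, Int.cast_sub]

/-- The field is real: exchanging the components of a letter exchanges `p` with the conjugate of
`q`, and the recursion has integer coefficients symmetric under this exchange. -/
theorem evalCoeff_map_swap (P : MvPolynomial (Fin 2) ℂ) (w : List (ℤ × ℤ)) :
    evalCoeff P (genPQ (w.map Prod.swap)).1 = starRingEnd ℂ (evalCoeff P (genPQ w).2) ∧
    evalCoeff P (genPQ (w.map Prod.swap)).2 = starRingEnd ℂ (evalCoeff P (genPQ w).1) := by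
  induction w using nested.induct with
  | case1 => simp [genPQ]
  | case2 n =>
    simp only [List.map_cons, List.map_nil, genPQ, evalCoeff_varP, evalCoeff_varQ]
    exact ⟨pc_swap P n, by rw [qc_conjSwap, Prod.swap_swap]⟩
  | case3 n m t ih =>
    have hq : qc (conjSwap P) n.swap = starRingEnd ℂ (pc P n) := by
      rw [qc_conjSwap, Prod.swap_swap]
    obtain ⟨h1, h2⟩ := evalCoeff_genPQ_cons P n m t
    obtain ⟨h3, h4⟩ := evalCoeff_genPQ_cons P n.swap m.swap (t.map Prod.swap)
    obtain ⟨h5, h6⟩ := size_map_swap (m :: t)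
    rw [List.map_cons] at ih h5 h6
    rw [List.map_cons, List.map_cons, h1, h2, h3, h4, h5, h6, ih.1, ih.2, pc_swap, hq]
    simp

theorem bracketP_map_swap (P : MvPolynomial (Fin 2) ℂ) (w : List (ℤ × ℤ)) :
    bracketQ P (w.map Prod.swap) = starRingEnd ℂ (bracketP P w) := by
  rw [bracketQ_eq, bracketP_eq, (evalCoeff_map_swap P w).2]

theorem carr_map_conj (l : List ℂ) : carr (l.map (starRingEnd ℂ)) = starRingEnd ℂ (carr l) := by
  induction hn : l.length using Nat.strong_induction_on generalizing l with
  | _ n ih =>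
    subst hn
    rcases l with _ | ⟨z₁, _ | ⟨z₂, t⟩⟩
    · simp [carr_nil]
    · simp only [List.map_cons, List.map_nil, carr_singleton, map_eq_zero]
      split_ifs <;> simp
    · by_cases hz : z₁ = 0
      · simp [hz, carr_zero_cons_cons]
      · have e1 := ih (t.length + 1) (by simp) ((z₁ + z₂) :: t) (by simp)
        have e2 : ∀ j : ℕ, carr (starRingEnd ℂ z₁ :: (t.map (starRingEnd ℂ)).drop j) =
            starRingEnd ℂ (carr (z₁ :: t.drop j)) := by
          intro j
          rw [← ih (z₁ :: t.drop j).length (by simp) _ rfl, List.map_cons, List.map_drop]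
        have e3 : ∀ j : ℕ, carr (starRingEnd ℂ z₂ :: (t.map (starRingEnd ℂ)).take j) =
            starRingEnd ℂ (carr (z₂ :: t.take j)) := by
          intro j
          rw [← ih (z₂ :: t.take j).length (by simp) _ rfl, List.map_cons, List.map_take]
        rw [List.map_cons, map_add] at e1
        rw [List.map_cons, List.map_cons, carr, carr, if_neg hz,
          if_neg (by simpa using hz), e1, Fin.sum_univ_eq_sum_range (fun j =>
            carr (starRingEnd ℂ z₁ :: (t.map (starRingEnd ℂ)).drop j) *
              carr (starRingEnd ℂ z₂ :: (t.map (starRingEnd ℂ)).take j)),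
          Fin.sum_univ_eq_sum_range (fun j => carr (z₁ :: t.drop j) * carr (z₂ :: t.take j))]
        simp only [e2, e3, map_mul, map_add, map_neg, map_sum, map_inv₀, List.length_map]

theorem mould_map_swap (w : List (ℤ × ℤ)) :
    mould (w.map Prod.swap) = starRingEnd ℂ (mould w) := by
  rw [mould, mould, ← carr_map_conj, List.map_reverse, List.map_map, List.map_map]
  congr 3
  funext n
  simp [weight]
  ring

theorem map_swap_mem_words {q l : ℕ} {w : List (ℤ × ℤ)} (hw : w ∈ words d q l) :
    w.map Prod.swap ∈ words d q l := by
  obtain ⟨⟨h1, h2⟩, h3⟩ := mem_words.1 hw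
  refine mem_words.2 ⟨⟨by simpa using h1, fun n hn => ?_⟩, ?_⟩
  · obtain ⟨m, hm, rfl⟩ := List.mem_map.1 hn
    have := h2 m hm
    rw [mem_alphabet] at this ⊢
    simp only [Prod.fst_swap, Prod.snd_swap]
    omega
  · rw [(size_map_swap w).1, (size_map_swap w).2, add_comm, h3]

/-- Exchanging components permutes the words of fixed depth and length, conjugates the mould because
weights change sign and are imaginary, and turns conjugates of `P(w)` into `Q`. -/
theorem conj_caLen (P : MvPolynomial (Fin 2) ℂ) (p l : ℕ) : starRingEnd ℂ (caLen P d p l) =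
    ∑ w ∈ words d (2 * p) l, mould w * bracketQ P w := by
  rw [caLen, map_sum]
  refine sum_nbij' (List.map Prod.swap) (List.map Prod.swap) (fun _ => map_swap_mem_words)
    (fun _ => map_swap_mem_words) (fun w _ => ?_) (fun w _ => ?_) (fun w _ => ?_)
  · simp
  · simp
  · rw [mould_map_swap, bracketP_map_swap, map_mul]

theorem corrPart_eq (p : ℕ) : corrPart P d (2 * p) =
    homVF p p (ca P d p) (starRingEnd ℂ (ca P d p)) := by
  have h1 : starRingEnd ℂ (ca P d p) = ∑ l ∈ Icc 1 (2 * p), (l : ℂ)⁻¹ *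
      ∑ w ∈ words d (2 * p) l, mould w * bracketQ P w := by
    rw [ca, map_sum]
    refine sum_congr rfl fun l _ => ?_
    rw [map_mul, conj_caLen]
    simp
  rw [h1, ca, ← sum_homVF, corrPart]
  refine sum_congr rfl fun l _ => ?_
  rw [one_div, ← smul_homVF, caLen, ← sum_homVF]
  congr 1
  refine sum_congr rfl fun w hw => ?_
  -- A nonzero mould forces resonance, and at depth `2p` both sizes then equal `p`; this is where
  -- the factor `(xy)^p` comes from.
  by_cases h : mould w = 0
  · rw [h, zero_smul, zero_mul, zero_mul]
    apply derivation_ext <;> simp [homVF, zmon_zero]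
  · obtain ⟨h2, h3⟩ := size_eq_of_resonant hw (wt_eq_zero_of_mouldOf_ne_zero h)
    rw [nested_eq_homVF, smul_homVF, h2, h3]

end Depth

/-! ### The polynomials in the coefficients -/

section Polynomials

theorem isHomogeneous_varP (n : ℤ × ℤ) : (varP n).IsHomogeneous 1 := by
  unfold varP
  split_ifs
  · exact MvPolynomial.isHomogeneous_X _ _
  · exact MvPolynomial.isHomogeneous_zero _ _ _

theorem isHomogeneous_varQ (n : ℤ × ℤ) : (varQ n).IsHomogeneous 1 := by
  unfold varQ
  split_ifs
  · exact MvPolynomial.isHomogeneous_X _ _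
  · exact MvPolynomial.isHomogeneous_zero _ _ _

theorem isHomogeneous_genPQ (w : List (ℤ × ℤ)) :
    (genPQ w).1.IsHomogeneous w.length ∧ (genPQ w).2.IsHomogeneous w.length := by
  induction w using genPQ.induct with
  | case1 => exact ⟨MvPolynomial.isHomogeneous_zero _ _ _, MvPolynomial.isHomogeneous_zero _ _ _⟩
  | case2 n => exact ⟨isHomogeneous_varP n, isHomogeneous_varQ n⟩
  | case3 n m t ih =>
    have key : ∀ (k : ℤ) {F H : CoeffPoly ℤ}, F.IsHomogeneous 1 →
        H.IsHomogeneous (m :: t).length → (k • (F * H)).IsHomogeneous (n :: m :: t).length := by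
      intro k F H hF hH
      have h := (MvPolynomial.isHomogeneous_C ((ℤ × ℤ) ⊕ (ℤ × ℤ)) k).mul (hF.mul hH)
      rwa [zero_add, add_comm 1, ← MvPolynomial.smul_eq_C_mul] at h
    exact ⟨((key _ (isHomogeneous_varP n) ih.1).add (key _ (isHomogeneous_varQ n) ih.1)).sub
        (key _ (isHomogeneous_varP n) ih.2),
      ((key _ (isHomogeneous_varQ n) ih.2).add (key _ (isHomogeneous_varP n) ih.2)).sub
        (key _ (isHomogeneous_varQ n) ih.1)⟩

theorem isHomogeneous_caPoly (d p l : ℕ) : (caPoly d p l).IsHomogeneous l := by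
  refine MvPolynomial.IsHomogeneous.sum _ _ _ fun w hw => ?_
  obtain ⟨⟨rfl, -⟩, -⟩ := mem_words.1 hw
  rw [← zero_add w.length]
  exact (MvPolynomial.isHomogeneous_C _ _).mul ((isHomogeneous_genPQ w).1.map _)

/-- Each step of the recursion divides by one imaginary weight, and the product term lowers the
degree equally. The power of the imaginary unit compensates this, so one statement covers both
parities. -/
theorem carr_imaginary (l : List ℤ) : ∃ r : ℚ,
    carr (l.map fun k : ℤ => Complex.I * (k : ℂ)) * Complex.I ^ l.length = Complex.I * (r : ℂ) := by
  induction hn : l.length using Nat.strong_induction_on generalizing l with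
  | _ n ih =>
    subst hn
    rcases l with _ | ⟨z₁, _ | ⟨z₂, t⟩⟩
    · exact ⟨0, by simp [carr_nil]⟩
    · rw [List.map_cons, List.map_nil, carr_singleton]
      by_cases h : Complex.I * (z₁ : ℂ) = 0
      · exact ⟨1, by simp [h]⟩
      · exact ⟨0, by rw [if_neg h]; simp⟩
    · by_cases hz : z₁ = 0
      · exact ⟨0, by simp [hz, carr_zero_cons_cons]⟩
      · set f : ℤ → ℂ := fun k => Complex.I * (k : ℂ) with hf
        obtain ⟨r, hr⟩ := ih (t.length + 1) (by simp) ((z₁ + z₂) :: t) (by simp)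
        have e2 : ∀ j : ℕ, ∃ s : ℚ, carr (f z₁ :: (t.map f).drop j) *
            Complex.I ^ (z₁ :: t.drop j).length = Complex.I * (s : ℂ) := by
          intro j
          have := ih (z₁ :: t.drop j).length (by simp) _ rfl
          rwa [List.map_cons, List.map_drop] at this
        have e3 : ∀ j : ℕ, ∃ s : ℚ, carr (f z₂ :: (t.map f).take j) *
            Complex.I ^ (z₂ :: t.take j).length = Complex.I * (s : ℂ) := by
          intro j
          have := ih (z₂ :: t.take j).length (by simp) _ rfl
          rwa [List.map_cons, List.map_take] at this
        choose a ha using e2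
        choose b hb using e3
        have hz' : (z₁ : ℂ) ≠ 0 := by exact_mod_cast hz
        have hfz : f z₁ ≠ 0 := mul_ne_zero Complex.I_ne_zero hz'
        have hadd : f (z₁ + z₂) = f z₁ + f z₂ := by simp [hf, mul_add]
        have hsum : (∑ j ∈ range (t.length + 1),
            carr (f z₁ :: (t.map f).drop j) * carr (f z₂ :: (t.map f).take j)) *
            Complex.I ^ (t.length + 2) =
            Complex.I * Complex.I * ((∑ j ∈ range (t.length + 1), a j * b j : ℚ) : ℂ) := by
          push_cast
          rw [sum_mul, mul_sum]
          refine sum_congr rfl fun j hj => ?_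
          have hj' := mem_range.1 hj
          have hlen : t.length + 2 = (z₁ :: t.drop j).length + (z₂ :: t.take j).length := by
            simp; omega
          rw [hlen, pow_add]
          linear_combination (carr (f z₂ :: (t.map f).take j) *
            Complex.I ^ (z₂ :: t.take j).length) * ha j + Complex.I * (a j : ℂ) * hb j
        -- After multiplication by the power of the imaginary unit, the bracket in the recursion
        -- becomes `r` minus the sum, and `1/(i z₁) = -i/z₁`.
        refine ⟨-(z₁ : ℚ)⁻¹ * (r - ∑ j ∈ range (t.length + 1), a j * b j), ?_⟩
        rw [List.map_cons, hadd] at hr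
        rw [List.map_cons, List.map_cons, carr, if_neg hfz, Fin.sum_univ_eq_sum_range (fun j =>
            carr (f z₁ :: (t.map f).drop j) * carr (f z₂ :: (t.map f).take j)), List.length_map,
          inv_mul_eq_div, div_mul_eq_mul_div, div_eq_iff hfz, List.length_cons, List.length_cons]
        push_cast at hsum ⊢
        have hI : Complex.I * Complex.I = -1 := Complex.I_mul_I
        have hc : (z₁ : ℂ)⁻¹ * z₁ = 1 := inv_mul_cancel₀ hz'
        have e : Complex.I * (-(z₁ : ℂ)⁻¹ * (r - ∑ j ∈ range (t.length + 1), (a j : ℂ) * b j)) *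
            f z₁ = -(Complex.I * Complex.I) * ((z₁ : ℂ)⁻¹ * z₁) *
              (r - ∑ j ∈ range (t.length + 1), (a j : ℂ) * b j) := by
          simp only [hf]; ring
        rw [e, hc, add_mul, hsum]
        linear_combination (-Complex.I) * hr

theorem mould_rational (w : List (ℤ × ℤ)) :
    ∃ r : ℚ, mould w * Complex.I ^ w.length = Complex.I * (r : ℂ) := by
  have h : (w.map weight).reverse =
      (w.map fun n => n.1 - n.2).reverse.map fun k : ℤ => Complex.I * (k : ℂ) := by
    rw [List.map_reverse, List.map_map]
    congr 2
    funext n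
    simp [weight]
  obtain ⟨r, hr⟩ := carr_imaginary (w.map fun n => n.1 - n.2).reverse
  refine ⟨r, ?_⟩
  rw [mould, h, ← hr]
  simp

theorem mould_rational_of_odd {w : List (ℤ × ℤ)} (h : Odd w.length) :
    ∃ r : ℚ, mould w = (r : ℂ) := by
  obtain ⟨r, hr⟩ := mould_rational w
  obtain ⟨k, hk⟩ := h
  -- With length `2k + 1` the power of the imaginary unit is `(-1)^k` times the unit itself, which
  -- cancels against the one on the right.
  refine ⟨r * (-1) ^ k, ?_⟩
  rw [hk, pow_succ, pow_mul, Complex.I_sq] at hr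
  have h1 : ((-1 : ℂ) ^ k) * (-1) ^ k = 1 := by rw [← mul_pow]; simp
  have h2 : mould w * (-1) ^ k = r := mul_right_cancel₀ Complex.I_ne_zero (by
    linear_combination hr)
  push_cast
  linear_combination (-1 : ℂ) ^ k * h2 - mould w * h1

theorem mould_imaginary_of_even {w : List (ℤ × ℤ)} (h : Even w.length) :
    ∃ r : ℚ, mould w = Complex.I * (r : ℂ) := by
  obtain ⟨r, hr⟩ := mould_rational w
  obtain ⟨k, hk⟩ := h
  refine ⟨r * (-1) ^ k, ?_⟩
  rw [hk, ← two_mul, pow_mul, Complex.I_sq] at hr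
  have h1 : ((-1 : ℂ) ^ k) * (-1) ^ k = 1 := by rw [← mul_pow]; simp
  push_cast
  linear_combination (-1 : ℂ) ^ k * hr - mould w * h1

theorem coeff_caPoly (d p l : ℕ) (m : (ℤ × ℤ) ⊕ (ℤ × ℤ) →₀ ℕ) : (caPoly d p l).coeff m =
    ∑ w ∈ words d (2 * p) l, mould w * (((genPQ w).1.coeff m : ℤ) : ℂ) := by
  simp [caPoly, MvPolynomial.coeff_sum, MvPolynomial.coeff_C_mul, MvPolynomial.coeff_map]

theorem coeff_caPoly_of_odd {l : ℕ} (hl : Odd l) (d p : ℕ) (m : (ℤ × ℤ) ⊕ (ℤ × ℤ) →₀ ℕ) :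
    ∃ r : ℚ, (caPoly d p l).coeff m = (r : ℂ) := by
  have h : ∀ w ∈ words d (2 * p) l, ∃ r : ℚ, mould w = (r : ℂ) := by
    intro w hw
    obtain ⟨⟨rfl, -⟩, -⟩ := mem_words.1 hw
    exact mould_rational_of_odd hl
  choose! r hr using h
  refine ⟨∑ w ∈ words d (2 * p) l, r w * (((genPQ w).1.coeff m : ℤ) : ℚ), ?_⟩
  rw [coeff_caPoly]
  push_cast
  exact sum_congr rfl fun w hw => by rw [hr w hw]

theorem coeff_caPoly_of_even {l : ℕ} (hl : Even l) (d p : ℕ) (m : (ℤ × ℤ) ⊕ (ℤ × ℤ) →₀ ℕ) :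
    ∃ r : ℚ, (caPoly d p l).coeff m = Complex.I * (r : ℂ) := by
  have h : ∀ w ∈ words d (2 * p) l, ∃ r : ℚ, mould w = Complex.I * (r : ℂ) := by
    intro w hw
    obtain ⟨⟨rfl, -⟩, -⟩ := mem_words.1 hw
    exact mould_imaginary_of_even hl
  choose! r hr using h
  refine ⟨∑ w ∈ words d (2 * p) l, r w * (((genPQ w).1.coeff m : ℤ) : ℚ), ?_⟩
  rw [coeff_caPoly]
  push_cast
  rw [mul_sum]
  exact sum_congr rfl fun w hw => by rw [hr w hw, mul_assoc]

theorem caLen_eq_eval (P : MvPolynomial (Fin 2) ℂ) (d p l : ℕ) :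
    caLen P d p l = MvPolynomial.eval (coeffVal P) (caPoly d p l) := by
  rw [caLen, caPoly, map_sum]
  refine sum_congr rfl fun w _ => ?_
  rw [map_mul, MvPolynomial.eval_C, MvPolynomial.eval_map, bracketP_eq]
  rfl

end Polynomials

end CorrectionVF

end

/-! ### The main theorem -/

theorem mainTheorem7 (d p : ℕ) (hp : 1 ≤ p) :
    -- the correction exists, is unique, and its part of depth `2p` has the stated form
    (∀ P : MvPolynomial (Fin 2) ℂ, CorrectionVF.IsPerturbation d P →
      ∃ Z : CorrectionVF.VF,
        CorrectionVF.IsCorrection (CorrectionVF.realField P) Z ∧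
        (∀ Z' : CorrectionVF.VF,
          CorrectionVF.IsCorrection (CorrectionVF.realField P) Z' → Z' = Z) ∧
        ((CorrectionVF.depthPart (2 * p) Z : CorrectionVF.VF) :
          CorrectionVF.Ser →ₗ[ℂ] CorrectionVF.Ser) = CorrectionVF.mouldTerm P d (2 * p) ∧
        CorrectionVF.depthPart (2 * p) Z =
          (CorrectionVF.sx * CorrectionVF.sy) ^ p •
            CorrectionVF.vf
              (CorrectionVF.cst (CorrectionVF.ca P d p) * CorrectionVF.sx)
              (CorrectionVF.cst (starRingEnd ℂ (CorrectionVF.ca P d p)) * CorrectionVF.sy)) ∧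
    -- the numbers `P(w)`, `Q(w)` are the coefficients of the nested brackets of resonant words
    (∀ P : MvPolynomial (Fin 2) ℂ, CorrectionVF.IsPerturbation d P →
      ∀ l ∈ Finset.Icc 1 (2 * p), ∀ w ∈ CorrectionVF.words d (2 * p) l,
        (w.map CorrectionVF.weight).sum = 0 →
        CorrectionVF.nested P w =
          (CorrectionVF.sx * CorrectionVF.sy) ^ p •
            CorrectionVF.vf
              (CorrectionVF.cst (CorrectionVF.bracketP P w) * CorrectionVF.sx)
              (CorrectionVF.cst (CorrectionVF.bracketQ P w) * CorrectionVF.sy)) ∧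
    -- each `Ca_{2p,l}` is a polynomial of degree `l` with coefficients in `ℚ` or `iℚ`
    (∀ l ∈ Finset.Icc 1 (2 * p),
      (CorrectionVF.caPoly d p l).IsHomogeneous l ∧
      (Odd l → ∀ m, ∃ r : ℚ, (CorrectionVF.caPoly d p l).coeff m = (r : ℂ)) ∧
      (Even l → ∀ m, ∃ r : ℚ, (CorrectionVF.caPoly d p l).coeff m = Complex.I * (r : ℂ)) ∧
      ∀ P : MvPolynomial (Fin 2) ℂ, CorrectionVF.IsPerturbation d P →
        CorrectionVF.caLen P d p l =
          MvPolynomial.eval (CorrectionVF.coeffVal P) (CorrectionVF.caPoly d p l)) ∧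
    -- recursive computation of the `P(w)`, `Q(w)`
    (∀ P : MvPolynomial (Fin 2) ℂ, CorrectionVF.IsPerturbation d P →
      ∀ w : List (ℤ × ℤ), (∀ n ∈ w, n ∈ CorrectionVF.alphabet d) →
        CorrectionVF.bracketP P w =
          MvPolynomial.eval₂ (Int.castRingHom ℂ) (CorrectionVF.coeffVal P)
            (CorrectionVF.genPQ w).1 ∧
        CorrectionVF.bracketQ P w =
          MvPolynomial.eval₂ (Int.castRingHom ℂ) (CorrectionVF.coeffVal P)
            (CorrectionVF.genPQ w).2) ∧
    -- recursive computation of the mould: the variance formula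
    (∀ (z₁ z₂ : ℂ) (t : List ℂ),
      z₁ * CorrectionVF.carr (z₁ :: z₂ :: t) + CorrectionVF.carr ((z₁ + z₂) :: t) =
        ∑ j ∈ Finset.range (t.length + 2),
          CorrectionVF.carr (z₁ :: (z₂ :: t).drop j) *
            CorrectionVF.carr ((z₂ :: t).take j)) :=
  ⟨fun _ hP => ⟨CorrectionVF.correction _ d, CorrectionVF.isCorrection_correction hP,
      fun _ hZ => hZ.eq_correction hP,
      by rw [CorrectionVF.depthPart_correction, CorrectionVF.coe_corrPart],
      by rw [CorrectionVF.depthPart_correction, CorrectionVF.corrPart_eq,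
        CorrectionVF.homVF_diag]⟩,
    fun _ _ _ _ w hw hres => by
      obtain ⟨h1, h2⟩ := CorrectionVF.size_eq_of_resonant hw hres
      rw [← CorrectionVF.homVF_diag, CorrectionVF.nested_eq_homVF, h1, h2],
    fun _ _ => ⟨CorrectionVF.isHomogeneous_caPoly d p _,
      fun h m => CorrectionVF.coeff_caPoly_of_odd h d p m,
      fun h m => CorrectionVF.coeff_caPoly_of_even h d p m,
      fun P _ => CorrectionVF.caLen_eq_eval P d p _⟩,
    fun P _ w _ => ⟨CorrectionVF.bracketP_eq P w, CorrectionVF.bracketQ_eq P w⟩,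
    CorrectionVF.carr_variance⟩
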